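/- Let $G=(V,E)$ be a finite simple undirected graph. Call a finite simple graph a unit interval graph if its vertices can be represented by closed intervals of length $1$ on the real line in such a way that two distinct vertices are adjacent if and only if their intervals intersect. The chromatic symmetric function of $G$ is the formal power series $$X_G=\sum_{\kappa}\ \prod_{v\in V} x_{\kappa(v)}$$ in the variables $x_1,x_2,x_3,\dots$, where the sum is over all proper colorings $\kappa:V\to\{1,2,3,\dots\}$ of $G$. Let $e_i=\sum_{j_1<\cdots<j_i}x_{j_1}\cdots x_{j_i}$, and let $e_\lambda=e_{\lambda_1}e_{\lambda_2}\cdots e_{\lambda_\ell}$ for an integer partition $\lambda=(\lambda_1,\dots,\lambda_\ell)$ (so $e_\emptyset=1$). The graph $G$ is called $e$-positive if $X_G$ is a linear combination of the $e_\lambda$ with nonnegative integer coefficients. If both $G$ and its complement $\overline{G}$ are unit interval graphs, then $G$ is $e$-positive. -/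

import Mathlib

noncomputable section

namespace ChromaticSymmetric

/-- `G` is a unit interval graph: the vertices can be represented by closed intervals
`[a v, a v + 1]` of length one on the real line so that two distinct vertices are adjacent if and
only if their intervals intersect. -/
def IsUnitInterval {V : Type*} (G : SimpleGraph V) : Prop :=
  ∃ a : V → ℝ, ∀ u v : V, u ≠ v →
    (G.Adj u v ↔ (Set.Icc (a u) (a u + 1) ∩ Set.Icc (a v) (a v + 1)).Nonempty)

/-- The exponent vector of the monomial `∏ v, x_{κ v}`, in the variables `x_1, x_2, …` indexed by
the positive integers. -/
def colorExponent {V : Type*} [Fintype V] (κ : V → ℕ+) : ℕ+ →₀ ℕ :=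
  ∑ v, Finsupp.single (κ v) 1

/-- Only finitely many colorings give a prescribed monomial, so the coefficients of the
chromatic symmetric function below are counts of finite sets. -/
theorem finite_colorings {V : Type*} [Fintype V] (G : SimpleGraph V) (d : ℕ+ →₀ ℕ) :
    {κ : G.Coloring ℕ+ | colorExponent (fun v => κ v) = d}.Finite := by
  have hS : (Set.univ.pi fun _ : V => (d.support : Set ℕ+)).Finite :=
    Set.Finite.pi fun _ => d.support.finite_toSet
  refine Set.Finite.of_finite_image (f := fun κ v => κ v) (hS.subset ?_) ?_
  · rintro _ ⟨κ, hκ, rfl⟩ v -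
    have hκ' : colorExponent (fun v => κ v) = d := hκ
    rw [Finset.mem_coe, Finsupp.mem_support_iff, ← hκ', colorExponent, Finsupp.finsetSum_apply]
    intro h0
    have := (Finset.sum_eq_zero_iff.mp h0) v (Finset.mem_univ v)
    simp at this
  · intro κ _ κ' _ h
    exact DFunLike.coe_injective h

/-- The chromatic symmetric function `X_G = ∑_κ ∏_v x_{κ v}`, the sum over all proper colorings
`κ : V → {1, 2, …}`, as a formal power series in infinitely many variables: the coefficient of
`x^d` is the number of proper colorings whose monomial is `x^d`. -/
def chromaticSymm {V : Type*} [Fintype V] (G : SimpleGraph V) : MvPowerSeries ℕ+ ℤ :=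
  fun d => ({κ : G.Coloring ℕ+ | colorExponent (fun v => κ v) = d}.ncard : ℤ)

open Classical in
/-- The elementary symmetric function `e_k = ∑_{j_1 < ⋯ < j_k} x_{j_1} ⋯ x_{j_k}` in the variables
`x_1, x_2, …`: a monomial has coefficient `1` if it is the product of `k` distinct variables, and
`0` otherwise. -/
def elemSymm (k : ℕ) : MvPowerSeries ℕ+ ℤ :=
  fun d => if ∃ s : Finset ℕ+, s.card = k ∧ ∑ j ∈ s, Finsupp.single j 1 = d then 1 else 0

/-- `e_μ = e_{μ_1} e_{μ_2} ⋯ e_{μ_ℓ}` for a partition `μ = (μ_1, …, μ_ℓ)`. -/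
def elemSymmPart {n : ℕ} (μ : n.Partition) : MvPowerSeries ℕ+ ℤ :=
  (μ.parts.map elemSymm).prod

/-- `f` is a (finite) nonnegative linear combination of the functions `e_μ`, for `μ` ranging over
all integer partitions. -/
def IsEPositiveSeries (f : MvPowerSeries ℕ+ ℤ) : Prop :=
  ∃ c : (Σ n : ℕ, n.Partition) →₀ ℤ,
    (∀ μ, 0 ≤ c μ) ∧ f = c.sum fun μ a => a • elemSymmPart μ.2

/-- A finite graph is `e`-positive if its chromatic symmetric function is. -/
def IsEPositive {V : Type*} [Fintype V] (G : SimpleGraph V) : Prop :=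
  IsEPositiveSeries (chromaticSymm G)

end ChromaticSymmetric

end

noncomputable section

namespace ChromaticSymmetric

open Finset

section

/-! ### Nonnegative combinations of elementary symmetric functions -/

/-! Very few graphs satisfy both hypotheses. A unit interval graph has no induced claw, 4-cycle,
5-cycle or net; applied to the complement, this also rules out in `G` a triangle with a vertex
adjacent to none of it, and two disjoint edges with no edge between them.

If `G` has no triangle, these exclusions leave a path on at most four vertices plus isolated
vertices (`isShortPath_of_triangle_free`); if it has no independent triple, the same holds for the
complement. Otherwise a triangle and an independent triple can be chosen to share a vertex
(`chromaticSymm_mem_of_triangles`). The five vertices involved then induce a bull, and no sixth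
vertex can be attached (`chromaticSymm_mem_of_meeting`, `mem_of_bull`).

For the surviving graphs, `X_G` is computed. Proper colorings are sorted by which vertices share a
color. The series of such a pattern depends only on its shape, by symmetry under permutations of
`V`, and the shapes needed are: all colors distinct, one equal pair, two disjoint equal pairs, one
equal triple. Each is expressed through the `e_k` by counting in two ways the colorings that are
injective away from one or two vertices. Adding up the patterns contained in the complement gives
nonnegative coefficients: the negative terms of the individual patterns are absorbed, chiefly by `n!
e_n`. Isolated vertices only contribute factors `e_1`, and paths reduce to complements of paths on
their own vertex set. -/

theorem elemSymm_zero : elemSymm 0 = 1 := by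
  classical
  ext d
  rw [MvPowerSeries.coeff_one]
  change (if _ then _ else _) = _
  congr 1
  simp [eq_comm]

theorem isEPositiveSeries_multiset_prod (s : Multiset ℕ) :
    IsEPositiveSeries (s.map elemSymm).prod := by
  classical
  refine ⟨Finsupp.single ⟨s.sum, Nat.Partition.ofSums s.sum s rfl⟩ 1, fun μ => ?_, ?_⟩
  · rw [Finsupp.single_apply]
    split_ifs <;> simp
  · rw [Finsupp.sum_single_index (by simp), one_smul, elemSymmPart, Nat.Partition.ofSums_parts]
    induction s using Multiset.induction with
    | empty => simp
    | cons a s ih =>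
      -- `Nat.Partition.ofSums` discards zero parts, which is harmless because `e_0 = 1`.
      by_cases ha : a = 0
      · simp [ha, elemSymm_zero, ih]
      · simp [ha, ih]

theorem isEPositiveSeries_zero : IsEPositiveSeries 0 := ⟨0, by simp, by simp⟩

theorem IsEPositiveSeries.add {f g : MvPowerSeries ℕ+ ℤ} (hf : IsEPositiveSeries f)
    (hg : IsEPositiveSeries g) : IsEPositiveSeries (f + g) := by
  classical
  obtain ⟨c, hc, rfl⟩ := hf
  obtain ⟨c', hc', rfl⟩ := hg
  refine ⟨c + c', fun μ => add_nonneg (hc μ) (hc' μ), ?_⟩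
  rw [Finsupp.sum_add_index']
  · simp
  · intro μ a b
    rw [add_smul]

/-- The semiring of nonnegative integer combinations of products of elementary symmetric
functions. -/
def elemCone : Subsemiring (MvPowerSeries ℕ+ ℤ) := Subsemiring.closure (Set.range elemSymm)

theorem elemSymm_mem (k : ℕ) : elemSymm k ∈ elemCone :=
  Subsemiring.subset_closure ⟨k, rfl⟩

theorem isEPositiveSeries_of_mem {f : MvPowerSeries ℕ+ ℤ} (hf : f ∈ elemCone) :
    IsEPositiveSeries f := by
  rw [elemCone, Subsemiring.mem_closure_iff] at hf
  induction hf using AddSubmonoid.closure_induction with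
  | zero => exact isEPositiveSeries_zero
  | add f g _ _ hf hg => exact hf.add hg
  | mem f hf =>
    obtain ⟨l, hl, rfl⟩ := Submonoid.exists_multiset_of_mem_closure hf
    have : ∃ s : Multiset ℕ, s.map elemSymm = l := by
      induction l using Multiset.induction with
      | empty => exact ⟨0, rfl⟩
      | cons a l ih =>
        obtain ⟨k, hk⟩ := hl a (by simp)
        obtain ⟨s, hs⟩ := ih
          (fun y hy => hl y (Multiset.mem_cons_of_mem hy))
          (Submonoid.multiset_prod_mem _ _ fun y hy =>
            Submonoid.subset_closure (hl y (Multiset.mem_cons_of_mem hy)))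
        exact ⟨k ::ₘ s, by simp [hk, hs]⟩
    obtain ⟨s, rfl⟩ := this
    exact isEPositiveSeries_multiset_prod s

/-! ### Series counting colorings with a given property -/

variable {V W : Type*} [Fintype V] [Fintype W]

theorem finite_colorExponent_eq (d : ℕ+ →₀ ℕ) :
    {κ : V → ℕ+ | colorExponent κ = d}.Finite := by
  refine ((finite_colorings (⊥ : SimpleGraph V) d).image fun κ v => κ v).subset fun κ hκ => ?_
  exact ⟨SimpleGraph.Coloring.mk κ (by simp), hκ, rfl⟩

/-- The finite set of maps to the positive integers with a prescribed monomial. -/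
def colorings (V : Type*) [Fintype V] (d : ℕ+ →₀ ℕ) : Finset (V → ℕ+) :=
  (finite_colorExponent_eq d).toFinset

@[simp] theorem mem_colorings {d : ℕ+ →₀ ℕ} {κ : V → ℕ+} :
    κ ∈ colorings V d ↔ colorExponent κ = d := by
  simp [colorings]

open Classical in
/-- The sum of the monomials of all maps to the positive integers that satisfy `P`. -/
def countSeries (P : (V → ℕ+) → Prop) : MvPowerSeries ℕ+ ℤ :=
  fun d => (#{κ ∈ colorings V d | P κ} : ℤ)

open Classical in
theorem coeff_countSeries (P : (V → ℕ+) → Prop) (d : ℕ+ →₀ ℕ) :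
    MvPowerSeries.coeff d (countSeries P) = (#{κ ∈ colorings V d | P κ} : ℤ) := rfl

theorem countSeries_congr {P Q : (V → ℕ+) → Prop} (h : ∀ κ, P κ ↔ Q κ) :
    countSeries P = countSeries Q := by
  congr 1
  funext κ
  exact propext (h κ)

theorem countSeries_or {P Q R : (V → ℕ+) → Prop} (h : ∀ κ, P κ ↔ Q κ ∨ R κ)
    (hd : ∀ κ, Q κ → ¬ R κ) : countSeries P = countSeries Q + countSeries R := by
  classical
  ext d
  rw [map_add]
  simp only [coeff_countSeries, h]
  rw [filter_or, card_union_of_disjoint, Nat.cast_add]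
  rw [disjoint_filter]
  exact fun κ _ => hd κ

theorem countSeries_false {P : (V → ℕ+) → Prop} (h : ∀ κ, ¬ P κ) : countSeries P = 0 := by
  classical
  ext d
  simp [coeff_countSeries, h]

theorem countSeries_exists {ι : Type*} (s : Finset ι) {P : (V → ℕ+) → Prop}
    {Q : ι → (V → ℕ+) → Prop} (h : ∀ κ, P κ ↔ ∃ i ∈ s, Q i κ)
    (hd : ∀ κ, ∀ i ∈ s, ∀ j ∈ s, Q i κ → Q j κ → i = j) :
    countSeries P = ∑ i ∈ s, countSeries (Q i) := by
  classical
  induction s using Finset.induction_on generalizing P with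
  | empty => exact (countSeries_false (by simpa using h)).trans (by simp)
  | insert i s hi ih =>
    rw [sum_insert hi]
    rw [← ih (P := fun κ => ∃ j ∈ s, Q j κ) (fun _ => Iff.rfl)
      (fun κ j hj k hk => hd κ j (mem_insert_of_mem hj) k (mem_insert_of_mem hk))]
    refine countSeries_or (fun κ => by rw [h]; simp) ?_
    rintro κ h1 ⟨j, hj, h2⟩
    have := hd κ i (mem_insert_self _ _) j (mem_insert_of_mem hj) h1 h2
    exact hi (this ▸ hj)

/-! ### Relabelling vertices, products over disjoint unions, and the basic series. -/

theorem colorExponent_comp_equiv (e : V ≃ W) (κ : W → ℕ+) :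
    colorExponent (κ ∘ e) = colorExponent κ :=
  e.sum_comp fun w => Finsupp.single (κ w) 1

theorem countSeries_equiv (e : V ≃ W) {P : (V → ℕ+) → Prop} {Q : (W → ℕ+) → Prop}
    (h : ∀ κ, P (κ ∘ e) ↔ Q κ) : countSeries P = countSeries Q := by
  classical
  ext d
  rw [coeff_countSeries, coeff_countSeries, Nat.cast_inj]
  refine card_nbij' (fun κ => κ ∘ e.symm) (fun κ => κ ∘ e) ?_ ?_ ?_ ?_
  · intro κ hκ
    simp only [coe_filter, mem_colorings, Set.mem_ofPred_eq, colorExponent_comp_equiv, ← h] at hκ ⊢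
    simpa [Function.comp_assoc] using hκ
  · intro κ hκ
    simp only [coe_filter, mem_colorings, Set.mem_ofPred_eq, colorExponent_comp_equiv, h] at hκ ⊢
    exact hκ
  · intro κ _
    simp [Function.comp_assoc]
  · intro κ _
    simp [Function.comp_assoc]

theorem colorExponent_sumElim (κ : V → ℕ+) (κ' : W → ℕ+) :
    colorExponent (Sum.elim κ κ') = colorExponent κ + colorExponent κ' := by
  simp [colorExponent]

theorem countSeries_mul (P : (V → ℕ+) → Prop) (Q : (W → ℕ+) → Prop) :
    countSeries P * countSeries Q =
      countSeries fun κ : V ⊕ W → ℕ+ => P (κ ∘ Sum.inl) ∧ Q (κ ∘ Sum.inr) := by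
  classical
  ext d
  rw [MvPowerSeries.coeff_mul]
  simp only [coeff_countSeries]
  simp only [← Nat.cast_mul, ← Nat.cast_sum, Nat.cast_inj, ← card_product]
  rw [← card_sigma]
  refine card_nbij' (fun x => Sum.elim x.2.1 x.2.2)
    (fun κ => ⟨(colorExponent (κ ∘ Sum.inl), colorExponent (κ ∘ Sum.inr)),
      (κ ∘ Sum.inl, κ ∘ Sum.inr)⟩) ?_ ?_ ?_ ?_
  · rintro ⟨⟨d1, d2⟩, κ, κ'⟩ h
    simp only [coe_sigma, Set.mem_sigma_iff, mem_coe, HasAntidiagonal.mem_antidiagonal,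
      mem_product, mem_filter,
      mem_colorings] at h
    obtain ⟨rfl, ⟨rfl, hP⟩, rfl, hQ⟩ := h
    simp [colorExponent_sumElim, hP, hQ]
  · intro κ h
    simp only [coe_filter, mem_colorings, Set.mem_ofPred_eq] at h
    simp only [coe_sigma, Set.mem_sigma_iff, mem_coe, HasAntidiagonal.mem_antidiagonal,
      mem_product, mem_filter,
      mem_colorings, true_and]
    refine ⟨?_, h.2⟩
    rw [← colorExponent_sumElim, Sum.elim_comp_inl_inr, h.1]
  · rintro ⟨⟨d1, d2⟩, κ, κ'⟩ h
    simp only [coe_sigma, Set.mem_sigma_iff, mem_coe, HasAntidiagonal.mem_antidiagonal,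
      mem_product, mem_filter,
      mem_colorings] at h
    obtain ⟨rfl, ⟨rfl, hP⟩, rfl, hQ⟩ := h
    simp
  · intro κ _
    simp

theorem countSeries_subtype_mul (p : V → Prop) [Fintype {v // p v}] [Fintype {v // ¬ p v}]
    (P : ({v // p v} → ℕ+) → Prop) (Q : ({v // ¬ p v} → ℕ+) → Prop) :
    countSeries P * countSeries Q =
      countSeries fun κ : V → ℕ+ => P (fun v => κ v) ∧ Q (fun v => κ v) := by
  classical
  rw [countSeries_mul]
  exact countSeries_equiv (Equiv.sumCompl p) fun κ => Iff.rfl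

theorem colorExponent_of_injective {κ : V → ℕ+} (h : Function.Injective κ) :
    colorExponent κ = ∑ j ∈ univ.map ⟨κ, h⟩, Finsupp.single j 1 := by
  simp [colorExponent]

theorem sum_single_inj {s t : Finset ℕ+}
    (h : ∑ j ∈ s, Finsupp.single j 1 = (∑ j ∈ t, Finsupp.single j 1 : ℕ+ →₀ ℕ)) : s = t := by
  classical
  ext j
  have := DFunLike.congr_fun h j
  simp only [Finsupp.finsetSum_apply, Finsupp.single_apply, sum_ite_eq'] at this
  by_cases h1 : j ∈ s <;> by_cases h2 : j ∈ t <;> simp_all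

/-- Injective colorings with color set `s` are the bijections from `V` to `s`, so each squarefree
monomial of degree `|V|` occurs `|V|!` times. -/
theorem countSeries_injective :
    countSeries (fun κ : V → ℕ+ => Function.Injective κ) =
      ((Fintype.card V).factorial : MvPowerSeries ℕ+ ℤ) * elemSymm (Fintype.card V) := by
  classical
  ext d
  rw [← nsmul_eq_mul, map_nsmul, coeff_countSeries]
  change _ = _ • (if _ then _ else _)
  split_ifs with hd
  · obtain ⟨s, hs, rfl⟩ := hd
    rw [nsmul_eq_mul, mul_one, Nat.cast_inj]
    have hcard : Fintype.card V = Fintype.card s := by simp [hs]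
    rw [← Fintype.card_equiv (Fintype.equivOfCardEq hcard), ← card_univ]
    symm
    refine card_nbij (fun e v => (e v : ℕ+)) ?_ ?_ ?_
    · intro e _
      have hinj : Function.Injective fun v => (e v : ℕ+) :=
        Subtype.val_injective.comp e.injective
      simp only [coe_filter, mem_colorings, Set.mem_ofPred_eq]
      refine ⟨?_, hinj⟩
      rw [colorExponent_of_injective hinj]
      congr 1
      ext j
      simp only [mem_map, mem_univ, true_and, Function.Embedding.coeFn_mk]
      constructor
      · rintro ⟨v, rfl⟩
        exact (e v).2
      · intro hj
        exact ⟨e.symm ⟨j, hj⟩, by simp⟩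
    · intro e _ e' _ h
      ext v
      have := congr_fun h v
      simp only at this
      rw [this]
    · intro κ hκ
      simp only [coe_filter, mem_colorings, Set.mem_ofPred_eq] at hκ
      obtain ⟨h1, h2⟩ := hκ
      rw [colorExponent_of_injective h2] at h1
      have hmap := sum_single_inj h1
      have hmem : ∀ v, κ v ∈ s := fun v => by simp [← hmap]
      have hbij : Function.Bijective fun v => (⟨κ v, hmem v⟩ : s) := by
        rw [Fintype.bijective_iff_injective_and_card]
        exact ⟨fun v w h => h2 (congrArg Subtype.val h), hcard⟩
      exact ⟨Equiv.ofBijective _ hbij, by simp, rfl⟩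
  · rw [smul_zero, Nat.cast_eq_zero, card_eq_zero, eq_empty_iff_forall_notMem]
    intro κ hκ
    simp only [mem_filter] at hκ
    obtain ⟨hκ, hinj⟩ := hκ
    rw [mem_colorings, colorExponent_of_injective hinj] at hκ
    exact hd ⟨_, by simp, hκ⟩

theorem countSeries_true :
    countSeries (fun _ : V → ℕ+ => True) = elemSymm 1 ^ Fintype.card V := by
  classical
  induction h : Fintype.card V generalizing V with
  | zero =>
    have := Fintype.card_eq_zero_iff.mp h
    rw [countSeries_congr (Q := fun κ => Function.Injective κ), countSeries_injective, h]
    · simp [elemSymm_zero]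
    · exact fun κ => iff_of_true trivial (Function.injective_of_subsingleton κ)
  | succ n ih =>
    obtain ⟨b⟩ : Nonempty V := Fintype.card_pos_iff.mp (by omega)
    have h1 : Fintype.card {v // v = b} = 1 := by simp
    have h2 : Fintype.card {v // ¬ v = b} = n := by
      have := Fintype.card_subtype_compl (fun v => v = b)
      rw [this, h1, h]
      rfl
    have h3 : countSeries (fun _ : {v // v = b} → ℕ+ => True) = elemSymm 1 := by
      rw [countSeries_congr (Q := fun κ => Function.Injective κ), countSeries_injective, h1]
      · simp
      · exact fun κ => iff_of_true trivial (Function.injective_of_subsingleton κ)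
    rw [pow_succ', ← ih h2, ← h3]
    have := countSeries_subtype_mul (fun v => v = b) (fun _ => True) (fun _ => True)
    rw [this]
    exact countSeries_congr fun _ => by simp

theorem chromaticSymm_eq (G : SimpleGraph V) :
    chromaticSymm G = countSeries fun κ => ∀ x y, G.Adj x y → κ x ≠ κ y := by
  classical
  ext d
  rw [coeff_countSeries]
  change ((Set.ncard _ : ℕ) : ℤ) = _
  rw [Nat.cast_inj, ← Set.ncard_coe_finset]
  refine Set.ncard_congr (fun κ _ v => κ v) ?_ ?_ ?_
  · intro κ hκ
    simpa using ⟨hκ, fun x y h => κ.valid h⟩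
  · intro κ κ' _ _ h
    exact DFunLike.coe_injective h
  · intro κ hκ
    simp only [coe_filter, mem_colorings, Set.mem_ofPred_eq] at hκ
    exact ⟨SimpleGraph.Coloring.mk κ fun {x y} h => hκ.2 x y h, hκ.1, rfl⟩

end

/-! ### Series of colorings with a prescribed coincidence pattern. -/

section

variable {V : Type*} [Fintype V]

/-- The series counting the colorings in which distinct `x`, `y` get equal colors exactly when
`r x y` holds. -/
def patternSeries (r : V → V → Prop) : MvPowerSeries ℕ+ ℤ :=
  countSeries fun κ => ∀ x y, x ≠ y → (κ x = κ y ↔ r x y)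

theorem patternSeries_perm (σ : Equiv.Perm V) {r r' : V → V → Prop}
    (h : ∀ x y, r x y ↔ r' (σ x) (σ y)) : patternSeries r = patternSeries r' := by
  refine countSeries_equiv σ fun κ => ?_
  simp only [h]
  constructor
  · intro H x y hxy
    have := H (σ.symm x) (σ.symm y) (by simpa using hxy)
    simpa using this
  · intro H x y hxy
    exact H _ _ (by simpa using hxy)

/-- Multiple transitivity of the symmetric group; it makes a pattern series depend only on the shape
of the pattern. -/
theorem exists_perm_apply_eq {V : Type*} {k : ℕ} (f g : Fin k ↪ V) :
    ∃ σ : Equiv.Perm V, ∀ i, σ (f i) = g i := by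
  classical
  have := Equiv.Perm.isMultiplyPretransitive V k
  obtain ⟨σ, hσ⟩ := MulAction.exists_smul_eq (Equiv.Perm V) f g
  exact ⟨σ, fun i => DFunLike.congr_fun hσ i⟩

/-- The colorings in which `a`, `b` is the only pair of vertices with the same color. -/
def pairSeries (a b : V) : MvPowerSeries ℕ+ ℤ :=
  patternSeries fun x y => s(x, y) = s(a, b)

/-- The colorings in which `a`, `b` and `c`, `d` are the only pairs with the same color. -/
def twoPairSeries (a b c d : V) : MvPowerSeries ℕ+ ℤ :=
  patternSeries fun x y => s(x, y) = s(a, b) ∨ s(x, y) = s(c, d)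

/-- The colorings in which `a`, `b`, `c` have the same color and there are no other
coincidences. -/
def tripleSeries (a b c : V) : MvPowerSeries ℕ+ ℤ :=
  patternSeries fun x y => s(x, y) = s(a, b) ∨ s(x, y) = s(b, c) ∨ s(x, y) = s(a, c)

theorem map_sym2_eq {V : Type*} (σ : Equiv.Perm V) (x y a b : V) :
    s(σ x, σ y) = s(σ a, σ b) ↔ s(x, y) = s(a, b) := by
  simp

theorem pairSeries_eq {a b a' b' : V} (h : a ≠ b) (h' : a' ≠ b') :
    pairSeries a b = pairSeries a' b' := by
  obtain ⟨σ, hσ⟩ := exists_perm_apply_eq (⟨![a, b], by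
    intro i j; fin_cases i <;> fin_cases j <;> simp_all [eq_comm]⟩ : Fin 2 ↪ V) ⟨![a', b'], by
    intro i j; fin_cases i <;> fin_cases j <;> simp_all [eq_comm]⟩
  obtain rfl : σ a = a' := hσ 0
  obtain rfl : σ b = b' := hσ 1
  exact patternSeries_perm σ fun x y => by rw [map_sym2_eq]

theorem tripleSeries_eq {a b c a' b' c' : V} (h : [a, b, c].Nodup) (h' : [a', b', c'].Nodup) :
    tripleSeries a b c = tripleSeries a' b' c' := by
  obtain ⟨σ, hσ⟩ := exists_perm_apply_eq (⟨_, List.nodup_iff_injective_get.mp h⟩ : Fin 3 ↪ V)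
    ⟨_, List.nodup_iff_injective_get.mp h'⟩
  obtain rfl : σ a = a' := hσ 0
  obtain rfl : σ b = b' := hσ 1
  obtain rfl : σ c = c' := hσ 2
  exact patternSeries_perm σ fun x y => by simp only [map_sym2_eq]

theorem twoPairSeries_eq {a b c d a' b' c' d' : V} (h : [a, b, c, d].Nodup)
    (h' : [a', b', c', d'].Nodup) : twoPairSeries a b c d = twoPairSeries a' b' c' d' := by
  obtain ⟨σ, hσ⟩ := exists_perm_apply_eq (⟨_, List.nodup_iff_injective_get.mp h⟩ : Fin 4 ↪ V)
    ⟨_, List.nodup_iff_injective_get.mp h'⟩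
  obtain rfl : σ a = a' := hσ 0
  obtain rfl : σ b = b' := hσ 1
  obtain rfl : σ c = c' := hσ 2
  obtain rfl : σ d = d' := hσ 3
  exact patternSeries_perm σ fun x y => by simp only [map_sym2_eq]

/-! ### Double counting of colorings injective away from one or two vertices. -/

theorem countSeries_compl_singleton_injective (b : V) :
    countSeries (fun κ : V → ℕ+ => ∀ x y, x ≠ b → y ≠ b → κ x = κ y → x = y) =
      ((Fintype.card V - 1).factorial : MvPowerSeries ℕ+ ℤ) * elemSymm (Fintype.card V - 1) *
        elemSymm 1 := by
  classical
  have h1 : Fintype.card {v // v = b} = 1 := by simp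
  have h2 : Fintype.card {v // ¬ v = b} = Fintype.card V - 1 := by
    rw [Fintype.card_subtype_compl (fun v => v = b), h1]
  have h3 := countSeries_true (V := {v // v = b})
  have h4 := countSeries_injective (V := {v // ¬ v = b})
  rw [h1, pow_one] at h3
  rw [h2] at h4
  rw [← h4, ← h3, mul_comm, countSeries_subtype_mul (fun v => v = b)]
  refine countSeries_congr fun κ => ?_
  simp only [true_and, Function.Injective, Subtype.forall, Subtype.mk.injEq]
  grind

/-- The colors of `b`, `c` are chosen independently of the others, so the series factors. Taking `Q`
to be `≠` or `=` isolates the patterns with two pairs and with a triple, respectively. -/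
theorem countSeries_compl_pair_injective {b c : V} (hbc : b ≠ c) (Q : ℕ+ → ℕ+ → Prop) :
    countSeries (fun κ : V → ℕ+ => (∀ x y, x ≠ b → x ≠ c → y ≠ b → y ≠ c → κ x = κ y → x = y) ∧
        Q (κ b) (κ c)) =
      ((Fintype.card V - 2).factorial : MvPowerSeries ℕ+ ℤ) * elemSymm (Fintype.card V - 2) *
        countSeries fun κ : Fin 2 → ℕ+ => Q (κ 0) (κ 1) := by
  classical
  have h1 : Fintype.card {v // v = b ∨ v = c} = 2 := by
    rw [Fintype.card_subtype]
    rw [card_eq_two]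
    exact ⟨b, c, hbc, by ext; simp⟩
  have h2 : Fintype.card {v // ¬ (v = b ∨ v = c)} = Fintype.card V - 2 := by
    rw [Fintype.card_subtype_compl (fun v => v = b ∨ v = c), h1]
  have h4 := countSeries_injective (V := {v // ¬ (v = b ∨ v = c)})
  rw [h2] at h4
  let f : Fin 2 → {v // v = b ∨ v = c} := ![⟨b, Or.inl rfl⟩, ⟨c, Or.inr rfl⟩]
  have hf : Function.Bijective f := by
    rw [Fintype.bijective_iff_injective_and_card]
    refine ⟨?_, by simp [h1]⟩
    intro i j
    fin_cases i <;> fin_cases j <;> simp [f, hbc, hbc.symm]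
  have h3 : countSeries (fun κ : Fin 2 → ℕ+ => Q (κ 0) (κ 1)) =
      countSeries (fun κ : {v // v = b ∨ v = c} → ℕ+ =>
        Q (κ ⟨b, Or.inl rfl⟩) (κ ⟨c, Or.inr rfl⟩)) :=
    countSeries_equiv (Equiv.ofBijective f hf) fun κ => Iff.rfl
  rw [← h4, h3, mul_comm, countSeries_subtype_mul (fun v => v = b ∨ v = c)]
  refine countSeries_congr fun κ => ?_
  simp only [Function.Injective, Subtype.forall, Subtype.mk.injEq]
  grind

/-- Since the other vertices have distinct colors, `b` repeats the color of at most one of them. -/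
theorem countSeries_compl_singleton_eq [DecidableEq V] (b : V) :
    countSeries (fun κ : V → ℕ+ => ∀ x y, x ≠ b → y ≠ b → κ x = κ y → x = y) =
      countSeries (fun κ : V → ℕ+ => Function.Injective κ) +
        ∑ a with a ≠ b, pairSeries a b := by
  classical
  have hsum : ∑ a with a ≠ b, pairSeries a b = _ :=
    (countSeries_exists (P := fun κ : V → ℕ+ => ∃ a ∈ ({a | a ≠ b} : Finset V),
      ∀ x y, x ≠ y → (κ x = κ y ↔ s(x, y) = s(a, b))) _ (fun _ => Iff.rfl) ?_).symm
  · rw [hsum]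
    apply countSeries_or
    · intro κ
      simp only [mem_filter, mem_univ, true_and, Function.Injective, Sym2.eq_iff]
      constructor
      · intro h
        replace h : ∀ x y, κ x = κ y → x = y ∨ x = b ∨ y = b := by
          intro x y
          have := h x y
          tauto
        by_cases h' : ∃ a, a ≠ b ∧ κ a = κ b
        · obtain ⟨a, ha, hab⟩ := h'
          exact Or.inr ⟨a, ha, fun x y hxy => by grind⟩
        · grind
      · rintro (h | ⟨a, ha, h⟩) <;> grind
    · rintro κ hκ ⟨a, ha, h⟩
      have := (h a b (by simpa using ha)).mpr rfl
      simp [hκ this] at ha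
  · intro κ a ha a' ha' h h'
    simp only [mem_filter, mem_univ, true_and] at ha
    have := (h' a b ha).mp ((h a b ha).mpr rfl)
    simp only [Sym2.eq_iff] at this
    grind

theorem sum_pairSeries_eq [DecidableEq V] {b c : V} :
    ∑ a with a ≠ b ∧ a ≠ c, pairSeries a b = countSeries (fun κ : V → ℕ+ =>
      ∃ a, (a ≠ b ∧ a ≠ c) ∧ ∀ x y, x ≠ y → (κ x = κ y ↔ s(x, y) = s(a, b))) := by
  refine (countSeries_exists _ (fun κ => by simp) ?_).symm
  intro κ a ha a' ha' h h'
  simp only [mem_filter, mem_univ, true_and] at ha ha'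
  have := (h' a b ha.1).mp ((h a b ha.1).mpr rfl)
  simp only [Sym2.eq_iff] at this
  grind

theorem sum_twoPairSeries_eq [DecidableEq V] {b c : V} (hbc : b ≠ c) :
    ∑ p : V × V with p.1 ≠ p.2 ∧ p.1 ≠ b ∧ p.1 ≠ c ∧ p.2 ≠ b ∧ p.2 ≠ c,
      twoPairSeries p.1 b p.2 c = countSeries (fun κ : V → ℕ+ =>
      ∃ a d, (a ≠ d ∧ a ≠ b ∧ a ≠ c ∧ d ≠ b ∧ d ≠ c) ∧
        ∀ x y, x ≠ y → (κ x = κ y ↔ s(x, y) = s(a, b) ∨ s(x, y) = s(d, c))) := by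
  refine (countSeries_exists _ (fun κ => by simp) ?_).symm
  rintro κ ⟨a, d⟩ ha ⟨a', d'⟩ ha' h h'
  simp only [mem_filter, mem_univ, true_and] at ha ha' h h'
  have h1 := (h' a b ha.2.1).mp ((h a b ha.2.1).mpr (Or.inl rfl))
  have h2 := (h' d c ha.2.2.2.2).mp ((h d c ha.2.2.2.2).mpr (Or.inr rfl))
  simp only [Sym2.eq_iff] at h1 h2
  grind

/-- Either nothing repeats, only `b` repeats a color, only `c` does, or both do. In the last case
their partners differ because `κ b ≠ κ c`; the partners form an ordered pair, the first belonging to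
`b`. -/
theorem countSeries_compl_pair_ne_eq [DecidableEq V] {b c : V} (hbc : b ≠ c) :
    countSeries (fun κ : V → ℕ+ => (∀ x y, x ≠ b → x ≠ c → y ≠ b → y ≠ c → κ x = κ y → x = y) ∧
        κ b ≠ κ c) =
      countSeries (fun κ : V → ℕ+ => Function.Injective κ) +
        (∑ a with a ≠ b ∧ a ≠ c, pairSeries a b + (∑ a with a ≠ c ∧ a ≠ b, pairSeries a c +
        ∑ p : V × V with p.1 ≠ p.2 ∧ p.1 ≠ b ∧ p.1 ≠ c ∧ p.2 ≠ b ∧ p.2 ≠ c,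
          twoPairSeries p.1 b p.2 c)) := by
  rw [sum_pairSeries_eq, sum_pairSeries_eq, sum_twoPairSeries_eq hbc]
  rw [← countSeries_or (fun κ => Iff.rfl), ← countSeries_or (fun κ => Iff.rfl)]
  · apply countSeries_or
    · intro κ
      simp only [Function.Injective, Sym2.eq_iff]
      constructor
      · rintro ⟨h, hne⟩
        replace h : ∀ x y, κ x = κ y → x = y ∨ x = b ∨ x = c ∨ y = b ∨ y = c := by
          intro x y
          have := h x y
          tauto
        by_cases hb : ∃ a, a ≠ b ∧ a ≠ c ∧ κ a = κ b <;>
          by_cases hc : ∃ a, a ≠ b ∧ a ≠ c ∧ κ a = κ c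
        · obtain ⟨a, ha⟩ := hb
          obtain ⟨d, hd⟩ := hc
          refine Or.inr (Or.inr (Or.inr ⟨a, d, by grind, fun x y hxy => ?_⟩))
          grind
        · obtain ⟨a, ha⟩ := hb
          refine Or.inr (Or.inl ⟨a, by grind, fun x y hxy => ?_⟩)
          grind
        · obtain ⟨a, ha⟩ := hc
          refine Or.inr (Or.inr (Or.inl ⟨a, by grind, fun x y hxy => ?_⟩))
          grind
        · left
          grind
      · rintro (h | ⟨a, ha, h⟩ | ⟨a, ha, h⟩ | ⟨a, d, ha, h⟩)
        · exact ⟨fun x y _ _ _ _ hxy => h hxy, fun h' => hbc (h h')⟩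
        · refine ⟨fun x y _ _ _ _ hxy => ?_, ?_⟩ <;> grind
        · refine ⟨fun x y _ _ _ _ hxy => ?_, ?_⟩ <;> grind
        · refine ⟨fun x y _ _ _ _ hxy => ?_, ?_⟩ <;> grind
    · rintro κ hκ (⟨a, ha, h⟩ | ⟨a, ha, h⟩ | ⟨a, d, ha, h⟩)
      · exact ha.1 (hκ ((h a b ha.1).mpr rfl))
      · exact ha.1 (hκ ((h a c ha.1).mpr rfl))
      · exact ha.2.1 (hκ ((h a b ha.2.1).mpr (Or.inl rfl)))
  · rintro κ ⟨a, ha, h⟩ (⟨a', ha', h'⟩ | ⟨a', d, ha', h'⟩)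
    · have := (h' a b ha.1).mp ((h a b ha.1).mpr rfl)
      simp only [Sym2.eq_iff] at this
      grind
    · have := (h d c ha'.2.2.2.2).mp ((h' d c ha'.2.2.2.2).mpr (Or.inr rfl))
      simp only [Sym2.eq_iff] at this
      grind
  · rintro κ ⟨a, ha, h⟩ ⟨a', d, ha', h'⟩
    have := (h a' b ha'.2.1).mp ((h' a' b ha'.2.1).mpr (Or.inl rfl))
    simp only [Sym2.eq_iff] at this
    grind

theorem countSeries_compl_pair_apply_eq [DecidableEq V] {b c : V} (hbc : b ≠ c) :
    countSeries (fun κ : V → ℕ+ => (∀ x y, x ≠ b → x ≠ c → y ≠ b → y ≠ c → κ x = κ y → x = y) ∧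
        κ b = κ c) =
      pairSeries b c + ∑ a with a ≠ b ∧ a ≠ c, tripleSeries a b c := by
  have hsum : ∑ a with a ≠ b ∧ a ≠ c, tripleSeries a b c = _ :=
    (countSeries_exists (P := fun κ : V → ℕ+ => ∃ a, (a ≠ b ∧ a ≠ c) ∧ ∀ x y, x ≠ y →
      (κ x = κ y ↔ s(x, y) = s(a, b) ∨ s(x, y) = s(b, c) ∨ s(x, y) = s(a, c))) _
      (fun κ => by simp) ?_).symm
  · rw [hsum]
    apply countSeries_or
    · intro κ
      simp only [Sym2.eq_iff]
      constructor
      · rintro ⟨h, he⟩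
        replace h : ∀ x y, κ x = κ y → x = y ∨ x = b ∨ x = c ∨ y = b ∨ y = c := by
          intro x y
          have := h x y
          tauto
        by_cases hb : ∃ a, a ≠ b ∧ a ≠ c ∧ κ a = κ b
        · obtain ⟨a, ha⟩ := hb
          refine Or.inr ⟨a, by grind, fun x y hxy => ?_⟩
          grind
        · refine Or.inl fun x y hxy => ?_
          grind
      · rintro (h | ⟨a, ha, h⟩)
        · refine ⟨fun x y _ _ _ _ hxy => ?_, ?_⟩ <;> grind
        · refine ⟨fun x y _ _ _ _ hxy => ?_, ?_⟩ <;> grind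
    · rintro κ hκ ⟨a, ha, h⟩
      have := (hκ a b ha.1).mp ((h a b ha.1).mpr (Or.inl rfl))
      simp only [Sym2.eq_iff] at this
      grind
  · intro κ a ha a' ha' h h'
    simp only [mem_filter, mem_univ, true_and] at ha ha'
    have := (h' a b ha.1).mp ((h a b ha.1).mpr (Or.inl rfl))
    simp only [Sym2.eq_iff] at this
    grind

/-! ### Pattern series in terms of elementary symmetric functions -/

theorem countSeries_fin_two_ne :
    countSeries (fun κ : Fin 2 → ℕ+ => κ 0 ≠ κ 1) = 2 * elemSymm 2 := by
  have h := countSeries_injective (V := Fin 2)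
  simp only [Fintype.card_fin, Nat.factorial_two, Nat.cast_ofNat] at h
  rw [← h]
  refine countSeries_congr fun κ => ?_
  simp [Function.Injective, Fin.forall_fin_two, eq_comm]

theorem countSeries_fin_two_eq :
    countSeries (fun κ : Fin 2 → ℕ+ => κ 0 = κ 1) = elemSymm 1 ^ 2 - 2 * elemSymm 2 := by
  have h := countSeries_true (V := Fin 2)
  rw [Fintype.card_fin] at h
  rw [← countSeries_fin_two_ne, eq_sub_iff_add_eq, ← h]
  exact (countSeries_or (fun κ => by simp [em]) fun κ h h' => h' h).symm

/-- Allows the number of equal summands in a double count to be cancelled in the power series ring.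
-/
theorem natCast_succ_ne_zero (k : ℕ) : ((k : MvPowerSeries ℕ+ ℤ) + 1) ≠ 0 := by
  have : ((k : MvPowerSeries ℕ+ ℤ) + 1) = ((k + 1 : ℕ) : MvPowerSeries ℕ+ ℤ) := by push_cast; rfl
  rw [this]
  intro h
  have h1 := congrArg (MvPowerSeries.coeff 0) h
  rw [← nsmul_one, map_nsmul] at h1
  simp at h1
  omega

theorem card_filter_ne [DecidableEq V] (b : V) :
    #{a | a ≠ b} = Fintype.card V - 1 := by
  rw [filter_ne', card_erase_of_mem (mem_univ b), card_univ]

theorem card_filter_ne_and_ne [DecidableEq V] {b c : V} (hbc : b ≠ c) :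
    #{a | a ≠ b ∧ a ≠ c} = Fintype.card V - 2 := by
  have : ({a | a ≠ b ∧ a ≠ c} : Finset V) = univ \ {b, c} := by
    ext
    simp
  rw [this, card_sdiff_of_subset (subset_univ _), card_pair hbc, card_univ]

theorem card_filter_pairs [DecidableEq V] {b c : V} (hbc : b ≠ c) :
    #{p : V × V | p.1 ≠ p.2 ∧ p.1 ≠ b ∧ p.1 ≠ c ∧ p.2 ≠ b ∧ p.2 ≠ c} =
      (Fintype.card V - 2) * (Fintype.card V - 3) := by
  have : ({p : V × V | p.1 ≠ p.2 ∧ p.1 ≠ b ∧ p.1 ≠ c ∧ p.2 ≠ b ∧ p.2 ≠ c} : Finset (V × V)) =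
      offDiag {a | a ≠ b ∧ a ≠ c} := by
    ext
    simp
    tauto
  rw [this, offDiag_card, card_filter_ne_and_ne hbc, ← Nat.mul_sub_one, Nat.sub_sub]

theorem pairSeries_formula {k : ℕ} (hk : Fintype.card V = k + 2) {a b : V} (hab : a ≠ b) :
    pairSeries a b = (k.factorial : MvPowerSeries ℕ+ ℤ) *
      (elemSymm (k + 1) * elemSymm 1 - (k + 2) * elemSymm (k + 2)) := by
  classical
  have h := countSeries_compl_singleton_eq b
  rw [countSeries_compl_singleton_injective, countSeries_injective,
    sum_congr rfl (g := fun _ => pairSeries a b), sum_const, card_filter_ne, hk] at h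
  -- The vertex `b` has `k + 1` possible partners, all giving the same pair series.
  · apply mul_left_cancel₀ (natCast_succ_ne_zero k)
    rw [show k + 2 - 1 = k + 1 from rfl, Nat.factorial_succ (k + 1), Nat.factorial_succ k,
      nsmul_eq_mul] at h
    push_cast at h
    linear_combination -h
  · intro x hx
    exact pairSeries_eq (by simpa using hx) hab

theorem twoPairSeries_formula {k : ℕ} (hk : Fintype.card V = k + 4) {a b c d : V}
    (h : [a, b, c, d].Nodup) :
    twoPairSeries a b c d = (k.factorial : MvPowerSeries ℕ+ ℤ) *
      (2 * elemSymm (k + 2) * elemSymm 2 - 2 * (k + 2) * (elemSymm (k + 3) * elemSymm 1) +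
        (k + 4) * (k + 1) * elemSymm (k + 4)) := by
  classical
  have hbd : b ≠ d := by simp at h; tauto
  have hab : a ≠ b := by simp at h; tauto
  have H := countSeries_compl_pair_ne_eq hbd
  have h1 : ∀ x ∈ ({x | x ≠ b ∧ x ≠ d} : Finset V), pairSeries x b = pairSeries a b := by
    intro x hx
    exact pairSeries_eq (mem_filter.mp hx).2.1 hab
  have h2 : ∀ x ∈ ({x | x ≠ d ∧ x ≠ b} : Finset V), pairSeries x d = pairSeries a b := by
    intro x hx
    exact pairSeries_eq (mem_filter.mp hx).2.1 hab
  have h3 : ∀ p ∈ ({p | p.1 ≠ p.2 ∧ p.1 ≠ b ∧ p.1 ≠ d ∧ p.2 ≠ b ∧ p.2 ≠ d} : Finset (V × V)),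
      twoPairSeries p.1 b p.2 d = twoPairSeries a b c d := by
    rintro ⟨x, y⟩ hx
    refine twoPairSeries_eq ?_ h
    simp only [mem_filter, mem_univ, true_and] at hx
    simp
    grind
  rw [countSeries_compl_pair_injective hbd, countSeries_fin_two_ne, countSeries_injective,
    sum_congr rfl h1, sum_congr rfl h2, sum_congr rfl h3,
    sum_const, sum_const, sum_const, card_filter_ne_and_ne hbd, card_filter_ne_and_ne hbd.symm,
    card_filter_pairs hbd, pairSeries_formula (k := k + 2) hk hab, hk] at H
  -- The two cancelled factors multiply to `(k + 1) * (k + 2)`, the number of ordered pairs of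
  -- partners.
  apply mul_left_cancel₀ (natCast_succ_ne_zero k)
  apply mul_left_cancel₀ (natCast_succ_ne_zero (k + 1))
  rw [show k + 4 - 2 = k + 2 from rfl, show k + 4 - 3 = k + 1 from rfl,
    Nat.factorial_succ (k + 3), Nat.factorial_succ (k + 2), Nat.factorial_succ (k + 1),
    Nat.factorial_succ k] at H
  simp only [nsmul_eq_mul] at H
  push_cast at H ⊢
  linear_combination -H

/-- The factor `k + 1` counts the vertices that can join `b` and `c`; it is left in place and
cancelled only where the formula is used. The factor `e_1 ^ 2 - 2 e_2` is the power sum `p_2`, from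
the common color of `b` and `c`. -/
theorem tripleSeries_formula {k : ℕ} (hk : Fintype.card V = k + 3) {a b c : V}
    (h : [a, b, c].Nodup) :
    (k + 1) * tripleSeries a b c = ((k + 1).factorial : MvPowerSeries ℕ+ ℤ) *
      (elemSymm (k + 1) * (elemSymm 1 ^ 2 - 2 * elemSymm 2) -
        (elemSymm (k + 2) * elemSymm 1 - (k + 3) * elemSymm (k + 3))) := by
  classical
  have hbc : b ≠ c := by simp at h; tauto
  have H := countSeries_compl_pair_apply_eq hbc
  rw [countSeries_compl_pair_injective hbc, countSeries_fin_two_eq,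
    sum_congr rfl (g := fun _ => tripleSeries a b c), sum_const, card_filter_ne_and_ne hbc,
    pairSeries_formula (k := k + 1) hk hbc, hk, nsmul_eq_mul, show k + 3 - 2 = k + 1 from rfl] at H
  · push_cast at H
    linear_combination -H
  · intro x hx
    refine tripleSeries_eq ?_ h
    simp only [mem_filter, mem_univ, true_and] at hx
    simp [hx, hbc]

end

section

variable {V : Type*} [Fintype V]

/-! ### Graphs with few non-edges -/

theorem chromaticSymm_mem_of_top {G : SimpleGraph V} (h : ∀ x y, x ≠ y → G.Adj x y) :
    chromaticSymm G ∈ elemCone := by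
  rw [chromaticSymm_eq, countSeries_congr (Q := fun κ => Function.Injective κ),
    countSeries_injective]
  · exact mul_mem (natCast_mem _ _) (elemSymm_mem _)
  · intro κ
    constructor
    · intro h1 x y hxy
      by_contra hne
      exact h1 x y (h x y hne) hxy
    · intro h1 x y hxy he
      exact hxy.ne (h1 he)

theorem chromaticSymm_mem_of_compl_edge {G : SimpleGraph V} {a b : V} (hab : a ≠ b)
    (h : ∀ x y, x ≠ y → (G.Adj x y ↔ s(x, y) ≠ s(a, b))) :
    chromaticSymm G ∈ elemCone := by
  classical
  have hcard : 2 ≤ Fintype.card V := by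
    simpa [hab] using (card_le_univ ({a, b} : Finset V))
  obtain ⟨k, hk⟩ := Nat.exists_eq_add_of_le' hcard
  have key : chromaticSymm G =
      countSeries (fun κ : V → ℕ+ => Function.Injective κ) + pairSeries a b := by
    rw [chromaticSymm_eq]
    apply countSeries_or
    · intro κ
      simp only [Function.Injective, Sym2.eq_iff, ne_eq] at h ⊢
      have hG : (∀ x y, G.Adj x y → κ x ≠ κ y) ↔
          ∀ x y, κ x = κ y → x = y ∨ (x = a ∧ y = b ∨ x = b ∧ y = a) := by
        grind [G.ne_of_adj]
      rw [hG]
      by_cases h1 : κ a = κ b <;> grind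
    · intro κ h1 h2
      exact hab (h1 ((h2 a b hab).mpr rfl))
  -- The coefficient `(k + 2) * k` is what remains of `(k + 2)!` after removing the term `-(k + 2)`
  -- of the pair series, once `k!` is factored out.
  have : chromaticSymm G = (k.factorial : MvPowerSeries ℕ+ ℤ) *
      (elemSymm (k + 1) * elemSymm 1 + ((k + 2) * k : ℕ) * elemSymm (k + 2)) := by
    rw [key, countSeries_injective, pairSeries_formula hk hab, hk, Nat.factorial_succ (k + 1),
      Nat.factorial_succ k]
    push_cast
    ring
  rw [this]
  exact mul_mem (natCast_mem _ _) (add_mem (mul_mem (elemSymm_mem _) (elemSymm_mem _))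
    (mul_mem (natCast_mem _ _) (elemSymm_mem _)))

theorem chromaticSymm_mem_of_compl_path_three {G : SimpleGraph V} {a b c : V}
    (hn : [a, b, c].Nodup)
    (h : ∀ x y, x ≠ y → (G.Adj x y ↔ s(x, y) ≠ s(a, b) ∧ s(x, y) ≠ s(b, c))) :
    chromaticSymm G ∈ elemCone := by
  classical
  have hcard : 3 ≤ Fintype.card V := by
    have := card_le_univ [a, b, c].toFinset
    rwa [List.toFinset_card_of_nodup hn] at this
  obtain ⟨k, hk⟩ := Nat.exists_eq_add_of_le' hcard
  simp only [List.nodup_cons, List.mem_cons, List.not_mem_nil] at hn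
  have hab : a ≠ b := by tauto
  have hbc : b ≠ c := by tauto
  have hac : a ≠ c := by tauto
  have key : chromaticSymm G =
      countSeries (fun κ : V → ℕ+ => Function.Injective κ) + (pairSeries a b + pairSeries b c) := by
    rw [chromaticSymm_eq, pairSeries, pairSeries, patternSeries, patternSeries,
      ← countSeries_or fun κ => Iff.rfl]
    · apply countSeries_or
      · intro κ
        simp only [Function.Injective, Sym2.eq_iff, ne_eq] at h ⊢
        have hG : (∀ x y, G.Adj x y → κ x ≠ κ y) ↔ ∀ x y, κ x = κ y → x = y ∨
            (x = a ∧ y = b ∨ x = b ∧ y = a) ∨ (x = b ∧ y = c ∨ x = c ∧ y = b) := by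
          grind [G.ne_of_adj]
        rw [hG]
        by_cases h1 : κ a = κ b <;> by_cases h2 : κ b = κ c <;> grind
      · rintro κ h1 (h2 | h2)
        · exact hab (h1 ((h2 a b hab).mpr rfl))
        · exact hbc (h1 ((h2 b c hbc).mpr rfl))
    · intro κ h1 h2
      have := (h2 a b hab).mp ((h1 a b hab).mpr rfl)
      simp only [Sym2.eq_iff] at this
      grind
  have : chromaticSymm G = ((k + 1).factorial : MvPowerSeries ℕ+ ℤ) *
      (2 * (elemSymm (k + 2) * elemSymm 1) + ((k + 3) * k : ℕ) * elemSymm (k + 3)) := by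
    rw [key, countSeries_injective, pairSeries_formula (k := k + 1) hk hab,
      pairSeries_formula (k := k + 1) hk hbc, hk, Nat.factorial_succ (k + 2),
      Nat.factorial_succ (k + 1)]
    push_cast
    ring
  rw [this]
  exact mul_mem (natCast_mem _ _) (add_mem (mul_mem (ofNat_mem _ 2) (mul_mem (elemSymm_mem _)
    (elemSymm_mem _))) (mul_mem (natCast_mem _ _) (elemSymm_mem _)))

theorem chromaticSymm_mem_of_compl_path_four {G : SimpleGraph V} {a b c d : V}
    (hn : [a, b, c, d].Nodup)
    (h : ∀ x y, x ≠ y →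
      (G.Adj x y ↔ s(x, y) ≠ s(a, b) ∧ s(x, y) ≠ s(b, c) ∧ s(x, y) ≠ s(c, d))) :
    chromaticSymm G ∈ elemCone := by
  classical
  have hcard : 4 ≤ Fintype.card V := by
    have := card_le_univ [a, b, c, d].toFinset
    rwa [List.toFinset_card_of_nodup hn] at this
  obtain ⟨k, hk⟩ := Nat.exists_eq_add_of_le' hcard
  have hn' := hn
  simp only [List.nodup_cons, List.mem_cons, List.not_mem_nil] at hn'
  have hab : a ≠ b := by tauto
  have hbc : b ≠ c := by tauto
  have hcd : c ≠ d := by tauto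
  have hac : a ≠ c := by tauto
  have had : a ≠ d := by tauto
  have hbd : b ≠ d := by tauto
  -- The ends of a non-edge may share a color; on the path `a b c d` of non-edges, the only two that
  -- can do so at once are the disjoint ones `ab` and `cd`.
  have key : chromaticSymm G =
      countSeries (fun κ : V → ℕ+ => Function.Injective κ) +
        (pairSeries a b + (pairSeries b c + (pairSeries c d + twoPairSeries a b c d))) := by
    rw [chromaticSymm_eq, pairSeries, pairSeries, pairSeries, twoPairSeries, patternSeries,
      patternSeries, patternSeries, patternSeries, ← countSeries_or fun κ => Iff.rfl,
      ← countSeries_or fun κ => Iff.rfl, ← countSeries_or fun κ => Iff.rfl]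
    · apply countSeries_or
      · intro κ
        simp only [Function.Injective, Sym2.eq_iff, ne_eq] at h ⊢
        have hG : (∀ x y, G.Adj x y → κ x ≠ κ y) ↔ ∀ x y, κ x = κ y → x = y ∨
            (x = a ∧ y = b ∨ x = b ∧ y = a) ∨ (x = b ∧ y = c ∨ x = c ∧ y = b) ∨
            (x = c ∧ y = d ∨ x = d ∧ y = c) := by
          grind [G.ne_of_adj]
        rw [hG]
        clear h hG hn hn'
        constructor
        · intro H
          by_cases h1 : κ a = κ b <;> by_cases h2 : κ b = κ c <;> by_cases h3 : κ c = κ d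
          · grind
          · grind
          · exact Or.inr (Or.inr (Or.inr (Or.inr (by grind))))
          · exact Or.inr (Or.inl (by grind))
          · grind
          · exact Or.inr (Or.inr (Or.inl (by grind)))
          · exact Or.inr (Or.inr (Or.inr (Or.inl (by grind))))
          · exact Or.inl (by grind)
        · rintro (H | H | H | H | H) <;> grind
      · rintro κ h1 (h2 | h2 | h2 | h2)
        · exact hab (h1 ((h2 a b hab).mpr rfl))
        · exact hbc (h1 ((h2 b c hbc).mpr rfl))
        · exact hcd (h1 ((h2 c d hcd).mpr rfl))
        · exact hab (h1 ((h2 a b hab).mpr (Or.inl rfl)))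
    all_goals
      simp only [Sym2.eq_iff]
      clear h hn hn'
      intro κ h1 h2
      have e1 := h1 a b hab
      have e2 := h1 b c hbc
      have e3 := h1 c d hcd
      grind
  have : chromaticSymm G = (k.factorial : MvPowerSeries ℕ+ ℤ) *
      (2 * (elemSymm (k + 2) * elemSymm 2) +
        ((3 * k + 1) * (k + 2) : ℕ) * (elemSymm (k + 3) * elemSymm 1) +
        ((k + 4) * (k + 1) * (k * (k + 2) + 1) : ℕ) * elemSymm (k + 4)) := by
    rw [key, countSeries_injective, pairSeries_formula (k := k + 2) hk hab,
      pairSeries_formula (k := k + 2) hk hbc, pairSeries_formula (k := k + 2) hk hcd,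
      twoPairSeries_formula hk hn, hk, Nat.factorial_succ (k + 3), Nat.factorial_succ (k + 2),
      Nat.factorial_succ (k + 1), Nat.factorial_succ k]
    push_cast
    ring
  rw [this]
  exact mul_mem (natCast_mem _ _) (add_mem (add_mem (mul_mem (ofNat_mem _ 2) (mul_mem
    (elemSymm_mem _) (elemSymm_mem _))) (mul_mem (natCast_mem _ _) (mul_mem (elemSymm_mem _)
    (elemSymm_mem _)))) (mul_mem (natCast_mem _ _) (elemSymm_mem _)))

/-! ### Isolated vertices -/

theorem chromaticSymm_eq_induce_mul {G : SimpleGraph V} (s : Set V) [Fintype s]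
    (h : ∀ x y, G.Adj x y → x ∈ s ∧ y ∈ s) :
    ∃ m : ℕ, chromaticSymm G = chromaticSymm (G.induce s) * elemSymm 1 ^ m := by
  classical
  refine ⟨Fintype.card {v // ¬ v ∈ s}, ?_⟩
  rw [← countSeries_true, chromaticSymm_eq, chromaticSymm_eq]
  have := countSeries_subtype_mul (fun v => v ∈ s)
    (fun κ => ∀ x y, (G.induce s).Adj x y → κ x ≠ κ y) (fun _ => True)
  refine Eq.trans ?_ this.symm
  refine countSeries_congr fun κ => ?_
  simp only [and_true, SimpleGraph.comap_adj, Subtype.forall, Function.Embedding.subtype_apply]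
  exact ⟨fun H x hx y hy hxy => H x y hxy, fun H x y hxy => H x (h x y hxy).1 y (h x y hxy).2 hxy⟩

theorem chromaticSymm_mem_of_induce {G : SimpleGraph V} (s : Set V) [Fintype s]
    (h : ∀ x y, G.Adj x y → x ∈ s ∧ y ∈ s) (hs : chromaticSymm (G.induce s) ∈ elemCone) :
    chromaticSymm G ∈ elemCone := by
  obtain ⟨m, hm⟩ := chromaticSymm_eq_induce_mul s h
  rw [hm]
  exact mul_mem hs (pow_mem (elemSymm_mem 1) m)

theorem chromaticSymm_mem_of_bot {G : SimpleGraph V} (h : ∀ x y, ¬ G.Adj x y) :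
    chromaticSymm G ∈ elemCone := by
  classical
  refine chromaticSymm_mem_of_induce ∅ (fun x y hxy => (h x y hxy).elim) ?_
  exact chromaticSymm_mem_of_top fun x => x.2.elim

theorem chromaticSymm_mem_of_edge {G : SimpleGraph V} {a b : V} (hab : a ≠ b)
    (h : ∀ x y, x ≠ y → (G.Adj x y ↔ s(x, y) = s(a, b))) :
    chromaticSymm G ∈ elemCone := by
  classical
  simp only [Sym2.eq_iff] at h
  refine chromaticSymm_mem_of_induce {a, b} (fun x y hxy => ?_) ?_
  · have := (h x y hxy.ne).mp hxy
    grind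
  · refine chromaticSymm_mem_of_top ?_
    rintro ⟨x, hx⟩ ⟨y, hy⟩ hxy
    simp only [SimpleGraph.comap_adj, Function.Embedding.subtype_apply]
    grind

theorem chromaticSymm_mem_of_path_three {G : SimpleGraph V} {a b c : V} (hn : [a, b, c].Nodup)
    (h : ∀ x y, x ≠ y → (G.Adj x y ↔ s(x, y) = s(a, b) ∨ s(x, y) = s(b, c))) :
    chromaticSymm G ∈ elemCone := by
  classical
  simp only [Sym2.eq_iff] at h
  refine chromaticSymm_mem_of_induce {a, b, c} (fun x y hxy => ?_) ?_
  · have := (h x y hxy.ne).mp hxy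
    grind
  -- On its own three vertices the path is a complete graph minus the edge `ac`.
  · refine chromaticSymm_mem_of_compl_edge (a := ⟨a, by simp⟩) (b := ⟨c, by simp⟩) (by grind) ?_
    rintro ⟨x, hx⟩ ⟨y, hy⟩ hxy
    simp only [SimpleGraph.comap_adj, Function.Embedding.subtype_apply, ne_eq, Sym2.eq_iff,
      Subtype.mk.injEq] at hxy ⊢
    rw [h x y hxy]
    grind

theorem chromaticSymm_mem_of_path_four {G : SimpleGraph V} {a b c d : V}
    (hn : [a, b, c, d].Nodup)
    (h : ∀ x y, x ≠ y →
      (G.Adj x y ↔ s(x, y) = s(a, b) ∨ s(x, y) = s(b, c) ∨ s(x, y) = s(c, d))) :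
    chromaticSymm G ∈ elemCone := by
  classical
  simp only [Sym2.eq_iff] at h
  refine chromaticSymm_mem_of_induce {a, b, c, d} (fun x y hxy => ?_) ?_
  · have := (h x y hxy.ne).mp hxy
    grind
  -- The four-vertex path is self-complementary: the non-edges of `a b c d` form the path `b d a c`.
  · refine chromaticSymm_mem_of_compl_path_four (a := ⟨b, by simp⟩) (b := ⟨d, by simp⟩)
      (c := ⟨a, by simp⟩) (d := ⟨c, by simp⟩) (by simp at hn ⊢; grind) ?_
    rintro ⟨x, hx⟩ ⟨y, hy⟩ hxy
    simp only [SimpleGraph.comap_adj, Function.Embedding.subtype_apply, ne_eq, Sym2.eq_iff,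
      Subtype.mk.injEq] at hxy ⊢
    rw [h x y hxy]
    simp only [Set.mem_insert_iff, Set.mem_singleton_iff] at hx hy
    simp at hn
    rcases hx with rfl | rfl | rfl | rfl <;> rcases hy with rfl | rfl | rfl | rfl <;> grind

end

section

variable {V : Type*}

/-! ### The bull -/

theorem forall_adj_ne_iff {G : SimpleGraph V} {R : V → V → Prop}
    (h : ∀ x y, x ≠ y → (G.Adj x y ↔ ¬ R x y)) {κ : V → ℕ+} :
    (∀ x y, G.Adj x y → κ x ≠ κ y) ↔ ∀ x y, κ x = κ y → x = y ∨ R x y := by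
  constructor
  · intro H x y hxy
    by_contra! hc
    exact H x y ((h x y hc.1).mpr hc.2) hxy
  · intro H x y hxy he
    exact (H x y he).elim hxy.ne ((h x y hxy.ne).mp hxy)

/-- The non-edges of the bull form the triangle `v s t` with pendant edges `pt` and `qs`. Color
classes are cliques of that graph, so the patterns are: none, five single edges, three two-edge
matchings, and the triangle. -/
theorem bull_pattern_iff (κ : V → ℕ+) {v p q s t : V} (hvs : v ≠ s) (hvt : v ≠ t) (hpt : p ≠ t)
    (hqs : q ≠ s) (hst : s ≠ t) (hvp : v ≠ p) (hvq : v ≠ q) (hpq : p ≠ q) (hps : p ≠ s)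
    (hqt : q ≠ t) :
    (∀ x y, κ x = κ y → x = y ∨
      (x = v ∧ y = s ∨ x = s ∧ y = v) ∨ (x = v ∧ y = t ∨ x = t ∧ y = v) ∨
      (x = p ∧ y = t ∨ x = t ∧ y = p) ∨ (x = q ∧ y = s ∨ x = s ∧ y = q) ∨
      (x = s ∧ y = t ∨ x = t ∧ y = s)) ↔
      (∀ ⦃x y⦄, κ x = κ y → x = y) ∨
        (∀ x y, ¬ x = y → (κ x = κ y ↔ (x = v ∧ y = s ∨ x = s ∧ y = v))) ∨
        (∀ x y, ¬ x = y → (κ x = κ y ↔ (x = v ∧ y = t ∨ x = t ∧ y = v))) ∨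
        (∀ x y, ¬ x = y → (κ x = κ y ↔ (x = p ∧ y = t ∨ x = t ∧ y = p))) ∨
        (∀ x y, ¬ x = y → (κ x = κ y ↔ (x = q ∧ y = s ∨ x = s ∧ y = q))) ∨
        (∀ x y, ¬ x = y → (κ x = κ y ↔ (x = s ∧ y = t ∨ x = t ∧ y = s))) ∨
        (∀ x y, ¬ x = y → (κ x = κ y ↔
          (x = v ∧ y = s ∨ x = s ∧ y = v) ∨ (x = p ∧ y = t ∨ x = t ∧ y = p))) ∨
        (∀ x y, ¬ x = y → (κ x = κ y ↔
          (x = v ∧ y = t ∨ x = t ∧ y = v) ∨ (x = q ∧ y = s ∨ x = s ∧ y = q))) ∨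
        (∀ x y, ¬ x = y → (κ x = κ y ↔
          (x = p ∧ y = t ∨ x = t ∧ y = p) ∨ (x = q ∧ y = s ∨ x = s ∧ y = q))) ∨
        (∀ x y, ¬ x = y → (κ x = κ y ↔ (x = v ∧ y = s ∨ x = s ∧ y = v) ∨
          (x = s ∧ y = t ∨ x = t ∧ y = s) ∨ (x = v ∧ y = t ∨ x = t ∧ y = v))) := by
  constructor
  · intro H
    by_cases h1 : κ s = κ t
    · by_cases h2 : κ v = κ s
      · iterate 9 right
        grind
      · iterate 5 right
        left
        grind
    by_cases h2 : κ v = κ s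
    · by_cases h3 : κ p = κ t
      · iterate 6 right
        left
        grind
      · right
        left
        grind
    by_cases h3 : κ v = κ t
    · by_cases h4 : κ q = κ s
      · iterate 7 right
        left
        grind
      · iterate 2 right
        left
        grind
    by_cases h4 : κ p = κ t <;> by_cases h5 : κ q = κ s
    · iterate 8 right
      left
      grind
    · iterate 3 right
      left
      grind
    · iterate 4 right
      left
      grind
    · left
      grind
  · rintro (H | H | H | H | H | H | H | H | H | H) <;> grind

theorem chromaticSymm_mem_of_bull [Fintype V] {G : SimpleGraph V} {v p q s t : V}
    (hn : [v, p, q, s, t].Nodup) (hV : ∀ x, x ∈ [v, p, q, s, t])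
    (h : ∀ x y, x ≠ y → (G.Adj x y ↔ s(x, y) ≠ s(v, s) ∧ s(x, y) ≠ s(v, t) ∧ s(x, y) ≠ s(p, t) ∧
      s(x, y) ≠ s(q, s) ∧ s(x, y) ≠ s(s, t))) :
    chromaticSymm G ∈ elemCone := by
  classical
  have hcard : Fintype.card V = 5 := by
    have h1 := List.toFinset_card_of_nodup hn
    rwa [eq_univ_of_forall (s := [v, p, q, s, t].toFinset) (by simpa using hV), card_univ] at h1
  have hn' := hn
  simp only [List.nodup_cons, List.mem_cons, List.not_mem_nil] at hn'
  have hvs : v ≠ s := by tauto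
  have hvt : v ≠ t := by tauto
  have hpt : p ≠ t := by tauto
  have hqs : q ≠ s := by tauto
  have hst : s ≠ t := by tauto
  have hvp : v ≠ p := by tauto
  have hvq : v ≠ q := by tauto
  have hpq : p ≠ q := by tauto
  have hps : p ≠ s := by tauto
  have hqt : q ≠ t := by tauto
  have key : chromaticSymm G =
      countSeries (fun κ : V → ℕ+ => Function.Injective κ) +
        (pairSeries v s + (pairSeries v t + (pairSeries p t + (pairSeries q s + (pairSeries s t +
        (twoPairSeries v s p t + (twoPairSeries v t q s + (twoPairSeries p t q s +
        tripleSeries v s t)))))))) := by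
    rw [chromaticSymm_eq]
    simp only [pairSeries, twoPairSeries, tripleSeries, patternSeries]
    iterate 8 rw [← countSeries_or fun κ => Iff.rfl]
    · apply countSeries_or
      · intro κ
        simp only [Function.Injective, Sym2.eq_iff, ne_eq] at h ⊢
        have hG : (∀ x y, G.Adj x y → κ x ≠ κ y) ↔ ∀ x y, κ x = κ y → x = y ∨
            (x = v ∧ y = s ∨ x = s ∧ y = v) ∨ (x = v ∧ y = t ∨ x = t ∧ y = v) ∨
            (x = p ∧ y = t ∨ x = t ∧ y = p) ∨ (x = q ∧ y = s ∨ x = s ∧ y = q) ∨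
            (x = s ∧ y = t ∨ x = t ∧ y = s) := by
          refine forall_adj_ne_iff fun x y hxy => ?_
          rw [h x y hxy]
          simp only [not_or]
        rw [hG]
        exact bull_pattern_iff κ hvs hvt hpt hqs hst hvp hvq hpq hps hqt
      · rintro κ h1 (h2 | h2 | h2 | h2 | h2 | h2 | h2 | h2 | h2)
        · exact hvs (h1 ((h2 v s hvs).mpr rfl))
        · exact hvt (h1 ((h2 v t hvt).mpr rfl))
        · exact hpt (h1 ((h2 p t hpt).mpr rfl))
        · exact hqs (h1 ((h2 q s hqs).mpr rfl))
        · exact hst (h1 ((h2 s t hst).mpr rfl))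
        · exact hvs (h1 ((h2 v s hvs).mpr (Or.inl rfl)))
        · exact hvt (h1 ((h2 v t hvt).mpr (Or.inl rfl)))
        · exact hpt (h1 ((h2 p t hpt).mpr (Or.inl rfl)))
        · exact hvs (h1 ((h2 v s hvs).mpr (Or.inl rfl)))
    all_goals
      simp only [Sym2.eq_iff]
      clear h hV hn hn'
      intro κ h1 h2
      have e1 := h1 v s hvs
      have e2 := h1 v t hvt
      have e3 := h1 p t hpt
      have e4 := h1 q s hqs
      have e5 := h1 s t hst
      grind
  have hY {a b : V} (hab : a ≠ b) := pairSeries_formula (k := 3) hcard hab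
  have hT := tripleSeries_formula (k := 2) hcard (a := v) (b := s) (c := t) (by simp [*])
  have : chromaticSymm G = 2 * (elemSymm 3 * elemSymm 1 ^ 2) + 10 * (elemSymm 4 * elemSymm 1) +
      2 * (elemSymm 3 * elemSymm 2) + 10 * elemSymm 5 := by
    -- Multiplying by 3 matches the factor `k + 1` in `tripleSeries_formula` at `k = 2`.
    apply mul_left_cancel₀ (natCast_succ_ne_zero 2)
    rw [key, countSeries_injective, hY hvs, hY hvt, hY hpt, hY hqs, hY hst,
      twoPairSeries_formula (k := 1) hcard (a := v) (b := s) (c := p) (d := t)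
        (by simp [*, hps.symm]),
      twoPairSeries_formula (k := 1) hcard (a := v) (b := t) (c := q) (d := s)
        (by simp [*, hqt.symm, hst.symm]),
      twoPairSeries_formula (k := 1) hcard (a := p) (b := t) (c := q) (d := s)
        (by simp [*, hqt.symm, hst.symm]), hcard]
    norm_num [Nat.factorial, -mul_eq_mul_left_iff] at hT ⊢
    linear_combination hT
  rw [this]
  exact add_mem (add_mem (add_mem
    (mul_mem (ofNat_mem _ 2) (mul_mem (elemSymm_mem _) (pow_mem (elemSymm_mem _) _)))
    (mul_mem (ofNat_mem _ 10) (mul_mem (elemSymm_mem _) (elemSymm_mem _))))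
    (mul_mem (ofNat_mem _ 2) (mul_mem (elemSymm_mem _) (elemSymm_mem _))))
    (mul_mem (ofNat_mem _ 10) (elemSymm_mem _))

end

section

variable {V : Type*}

/-! ### Forbidden induced subgraphs of unit interval graphs -/

theorem IsUnitInterval.exists_abs_sub_le {G : SimpleGraph V} (hG : IsUnitInterval G) :
    ∃ a : V → ℝ, ∀ u v, u ≠ v → (G.Adj u v ↔ |a u - a v| ≤ 1) := by
  obtain ⟨a, ha⟩ := hG
  refine ⟨a, fun u v huv => (ha u v huv).trans ?_⟩
  rw [Set.Icc_inter_Icc, Set.nonempty_Icc, sup_le_iff, le_inf_iff, le_inf_iff, abs_le]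
  constructor
  · rintro ⟨⟨_, _⟩, _, _⟩
    constructor <;> linarith
  · rintro ⟨_, _⟩
    refine ⟨⟨?_, ?_⟩, ?_, ?_⟩ <;> linarith

/-- Three points pairwise more than 1 apart spread over more than 2, but all neighbors of `c` lie
within 1 of it. -/
theorem IsUnitInterval.not_claw {G : SimpleGraph V} (hG : IsUnitInterval G) {c x y z : V}
    (hx : G.Adj c x) (hy : G.Adj c y) (hz : G.Adj c z) (hxy : x ≠ y) (hyz : y ≠ z) (hxz : x ≠ z)
    (h1 : ¬ G.Adj x y) (h2 : ¬ G.Adj y z) (h3 : ¬ G.Adj x z) : False := by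
  obtain ⟨a, ha⟩ := hG.exists_abs_sub_le
  rw [ha _ _ hx.ne, abs_le] at hx
  rw [ha _ _ hy.ne, abs_le] at hy
  rw [ha _ _ hz.ne, abs_le] at hz
  rw [ha _ _ hxy, not_le, lt_abs] at h1
  rw [ha _ _ hyz, not_le, lt_abs] at h2
  rw [ha _ _ hxz, not_le, lt_abs] at h3
  rcases h1 with h1 | h1 <;> rcases h2 with h2 | h2 <;> rcases h3 with h3 | h3 <;> linarith

/-- The common neighbors of two points more than 1 apart lie in an interval of length less than 1,
so they are adjacent. -/
theorem IsUnitInterval.not_square {G : SimpleGraph V} (hG : IsUnitInterval G) {x y z w : V}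
    (hxy : G.Adj x y) (hyz : G.Adj y z) (hzw : G.Adj z w) (hwx : G.Adj w x) (h1 : x ≠ z)
    (h2 : y ≠ w) (h3 : ¬ G.Adj x z) (h4 : ¬ G.Adj y w) : False := by
  obtain ⟨a, ha⟩ := hG.exists_abs_sub_le
  rw [ha _ _ hxy.ne, abs_le] at hxy
  rw [ha _ _ hyz.ne, abs_le] at hyz
  rw [ha _ _ hzw.ne, abs_le] at hzw
  rw [ha _ _ hwx.ne, abs_le] at hwx
  rw [ha _ _ h1, not_le, lt_abs] at h3
  rw [ha _ _ h2, not_le, lt_abs] at h4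
  rcases h3 with h3 | h3 <;> rcases h4 with h4 | h4 <;> linarith

theorem IsUnitInterval.not_pentagon {G : SimpleGraph V} (hG : IsUnitInterval G) {x y z w u : V}
    (hxy : G.Adj x y) (hyz : G.Adj y z) (hzw : G.Adj z w) (hwu : G.Adj w u) (hux : G.Adj u x)
    (hxz : x ≠ z) (hxw : x ≠ w) (hyw : y ≠ w) (hyu : y ≠ u) (hzu : z ≠ u)
    (h1 : ¬ G.Adj x z) (h2 : ¬ G.Adj x w) (h3 : ¬ G.Adj y w) (h4 : ¬ G.Adj y u)
    (h5 : ¬ G.Adj z u) : False := by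
  obtain ⟨a, ha⟩ := hG.exists_abs_sub_le
  rw [ha _ _ hxy.ne, abs_le] at hxy
  rw [ha _ _ hyz.ne, abs_le] at hyz
  rw [ha _ _ hzw.ne, abs_le] at hzw
  rw [ha _ _ hwu.ne, abs_le] at hwu
  rw [ha _ _ hux.ne, abs_le] at hux
  rw [ha _ _ hxz, not_le, lt_abs] at h1
  rw [ha _ _ hxw, not_le, lt_abs] at h2
  rw [ha _ _ hyw, not_le, lt_abs] at h3
  rw [ha _ _ hyu, not_le, lt_abs] at h4
  rw [ha _ _ hzu, not_le, lt_abs] at h5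
  rcases h1 with h1 | h1 <;> rcases h2 with h2 | h2 <;> rcases h3 with h3 | h3 <;>
    rcases h4 with h4 | h4 <;> rcases h5 with h5 | h5 <;> linarith

theorem IsUnitInterval.not_net {G : SimpleGraph V} (hG : IsUnitInterval G) {x y z x' y' z' : V}
    (hxy : G.Adj x y) (hyz : G.Adj y z) (hxz : G.Adj x z) (hx : G.Adj x x') (hy : G.Adj y y')
    (hz : G.Adj z z') (hxy' : x' ≠ y') (hyz' : y' ≠ z') (hxz' : x' ≠ z')
    (h1 : ¬ G.Adj x' y') (h2 : ¬ G.Adj y' z') (h3 : ¬ G.Adj x' z')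
    (h4 : ¬ G.Adj x y') (h5 : ¬ G.Adj x z') (h6 : ¬ G.Adj y x') (h7 : ¬ G.Adj y z')
    (h8 : ¬ G.Adj z x') (h9 : ¬ G.Adj z y') : False := by
  have n4 : x ≠ y' := by rintro rfl; exact h1 hx.symm
  have n5 : x ≠ z' := by rintro rfl; exact h3 hx.symm
  have n6 : y ≠ x' := by rintro rfl; exact h1 hy
  have n7 : y ≠ z' := by rintro rfl; exact h2 hy.symm
  have n8 : z ≠ x' := by rintro rfl; exact h3 hz
  have n9 : z ≠ y' := by rintro rfl; exact h2 hz
  obtain ⟨a, ha⟩ := hG.exists_abs_sub_le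
  rw [ha _ _ hxy.ne, abs_le] at hxy
  rw [ha _ _ hyz.ne, abs_le] at hyz
  rw [ha _ _ hxz.ne, abs_le] at hxz
  rw [ha _ _ hx.ne, abs_le] at hx
  rw [ha _ _ hy.ne, abs_le] at hy
  rw [ha _ _ hz.ne, abs_le] at hz
  rw [ha _ _ hxy', not_le, lt_abs] at h1
  rw [ha _ _ hyz', not_le, lt_abs] at h2
  rw [ha _ _ hxz', not_le, lt_abs] at h3
  rw [ha _ _ n4, not_le, lt_abs] at h4
  rw [ha _ _ n5, not_le, lt_abs] at h5
  rw [ha _ _ n6, not_le, lt_abs] at h6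
  rw [ha _ _ n7, not_le, lt_abs] at h7
  rw [ha _ _ n8, not_le, lt_abs] at h8
  rw [ha _ _ n9, not_le, lt_abs] at h9
  clear ha n4 n5 n6 n7 n8 n9
  -- The signs order the three pendant vertices. The triangle vertices attached to the outer two
  -- miss the middle one, so they lie more than 1 away from it on opposite sides and cannot be
  -- adjacent. The two cyclic sign choices are impossible.
  rcases h1 with h1 | h1 <;> rcases h2 with h2 | h2 <;> rcases h3 with h3 | h3
  · rcases h4 with h4 | h4 <;> rcases h9 with h9 | h9 <;> linarith
  · linarith
  · rcases h5 with h5 | h5 <;> rcases h7 with h7 | h7 <;> linarith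
  · rcases h6 with h6 | h6 <;> rcases h8 with h8 | h8 <;> linarith
  · rcases h6 with h6 | h6 <;> rcases h8 with h8 | h8 <;> linarith
  · rcases h5 with h5 | h5 <;> rcases h7 with h7 | h7 <;> linarith
  · linarith
  · rcases h4 with h4 | h4 <;> rcases h9 with h9 | h9 <;> linarith

theorem IsUnitInterval.not_triangle_of_isolated {G : SimpleGraph V} (hG : IsUnitInterval Gᶜ)
    {x y z c : V} (hxy : G.Adj x y) (hyz : G.Adj y z) (hxz : G.Adj x z) (hx : c ≠ x) (hy : c ≠ y)
    (hz : c ≠ z) (h1 : ¬ G.Adj c x) (h2 : ¬ G.Adj c y) (h3 : ¬ G.Adj c z) : False :=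
  hG.not_claw (c := c) (x := x) (y := y) (z := z) ⟨hx, h1⟩ ⟨hy, h2⟩ ⟨hz, h3⟩ hxy.ne hyz.ne hxz.ne
    (fun h => h.2 hxy) (fun h => h.2 hyz) (fun h => h.2 hxz)

theorem IsUnitInterval.not_two_edges {G : SimpleGraph V} (hG : IsUnitInterval Gᶜ)
    {x y z w : V} (hxy : G.Adj x y) (hzw : G.Adj z w) (h1 : ¬ G.Adj x z) (h2 : ¬ G.Adj x w)
    (h3 : ¬ G.Adj y z) (h4 : ¬ G.Adj y w) : False :=
  hG.not_square (x := x) (y := z) (z := y) (w := w)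
    ⟨by rintro rfl; exact h2 hzw, h1⟩ ⟨by rintro rfl; exact h4 hzw, fun h => h3 h.symm⟩
    ⟨by rintro rfl; exact h3 hzw.symm, h4⟩ ⟨by rintro rfl; exact h1 hzw.symm, fun h => h2 h.symm⟩
    hxy.ne hzw.ne (fun h => h.2 hxy) (fun h => h.2 hzw)

/-! ### Classification -/

/-- Whatever the adjacencies of `w` to `p`, `q`, `s`, there appears a claw, a square, a net, or a
triangle together with a vertex adjacent to none of it. -/
theorem not_adj_of_bull {G : SimpleGraph V} (hG : IsUnitInterval G) (hGc : IsUnitInterval Gᶜ)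
    {v p q s t w : V} (vp : G.Adj v p) (vq : G.Adj v q) (pq : G.Adj p q) (vs : ¬ G.Adj v s)
    (st : ¬ G.Adj s t) (vt : ¬ G.Adj v t) (ps : G.Adj p s) (qt : G.Adj q t) (pt : ¬ G.Adj p t)
    (qs : ¬ G.Adj q s) (hn : [v, p, q, s, t].Nodup) (hw : w ∉ [v, p, q, s, t]) (wt : ¬ G.Adj w t)
    (wv : G.Adj w v) : False := by
  simp only [List.nodup_cons, List.mem_cons, List.not_mem_nil] at hn hw
  by_cases wq : G.Adj w q
  · by_cases wp : G.Adj w p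
    · by_cases ws : G.Adj w s
      · exact hGc.not_triangle_of_isolated (c := t) wp ps ws (by grind) (by grind) (by grind)
          (by rwa [G.adj_comm]) (by rwa [G.adj_comm]) (by rwa [G.adj_comm])
      · exact hGc.not_triangle_of_isolated (c := s) wv vq wq (by grind) (by grind) (by grind)
          (by rwa [G.adj_comm]) (by rwa [G.adj_comm]) (by rwa [G.adj_comm])
    · exact hG.not_claw qt wq.symm pq.symm (by grind) (by grind) (by grind)
        (by rwa [G.adj_comm]) wp (by rwa [G.adj_comm])
  · by_cases wp : G.Adj w p
    · exact hGc.not_triangle_of_isolated (c := t) wv vp wp (by grind) (by grind) (by grind)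
          (by rwa [G.adj_comm]) (by rwa [G.adj_comm]) (by rwa [G.adj_comm])
    · by_cases ws : G.Adj w s
      · exact hG.not_square wv vp ps ws.symm (by grind) (by grind) wp vs
      · exact hG.not_net vp pq vq wv.symm ps qt (by grind) (by grind) (by grind) ws st wt vs vt
          (by rwa [G.adj_comm]) pt (by rwa [G.adj_comm]) qs

theorem not_adj_of_bull' {G : SimpleGraph V} (hG : IsUnitInterval G) (hGc : IsUnitInterval Gᶜ)
    {v p q s t w : V} (vp : G.Adj v p) (vq : G.Adj v q) (pq : G.Adj p q) (vs : ¬ G.Adj v s)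
    (st : ¬ G.Adj s t) (vt : ¬ G.Adj v t) (ps : G.Adj p s) (qt : G.Adj q t) (pt : ¬ G.Adj p t)
    (qs : ¬ G.Adj q s) (hn : [v, p, q, s, t].Nodup) (hw : w ∉ [v, p, q, s, t])
    (wv : G.Adj w v) : False := by
  by_cases wt : G.Adj w t
  · by_cases ws : G.Adj w s
    · simp only [List.nodup_cons, List.mem_cons, List.not_mem_nil] at hn
      exact hG.not_claw wv ws wt (by grind) (by grind) (by grind) vs st vt
    -- The reflection of the bull exchanging `p` with `q` and `s` with `t` reduces to the case
    -- already excluded.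
    · refine not_adj_of_bull hG hGc vq vp pq.symm vt (by rwa [G.adj_comm]) vs qt ps qs pt ?_ ?_ ws wv
      · simp only [List.nodup_cons, List.mem_cons, List.not_mem_nil] at hn ⊢
        grind
      · simp only [List.mem_cons, List.not_mem_nil] at hw ⊢
        grind
  · exact not_adj_of_bull hG hGc vp vq pq vs st vt ps qt pt qs hn hw wt wv

theorem mem_of_bull {G : SimpleGraph V} (hG : IsUnitInterval G) (hGc : IsUnitInterval Gᶜ)
    {v p q s t : V} (vp : G.Adj v p) (vq : G.Adj v q) (pq : G.Adj p q) (vs : ¬ G.Adj v s)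
    (st : ¬ G.Adj s t) (vt : ¬ G.Adj v t) (ps : G.Adj p s) (qt : G.Adj q t) (pt : ¬ G.Adj p t)
    (qs : ¬ G.Adj q s) (hn : [v, p, q, s, t].Nodup) (w : V) : w ∈ [v, p, q, s, t] := by
  by_contra hw
  by_cases wv : G.Adj w v
  · exact not_adj_of_bull' hG hGc vp vq pq vs st vt ps qt pt qs hn hw wv
  · have hn' := hn
    have hw' := hw
    simp only [List.nodup_cons, List.mem_cons, List.not_mem_nil] at hn' hw'
    -- The bull is self-complementary with `v` in the same role, so a vertex not adjacent to `v` is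
    -- excluded by passing to the complement.
    refine not_adj_of_bull' (G := Gᶜ) (v := v) (p := s) (q := t) (s := q) (t := p) (w := w) hGc
      (by rwa [compl_compl]) ⟨by grind, vs⟩ ⟨by grind, vt⟩ ⟨by grind, st⟩ (fun h => h.2 vq)
      (fun h => h.2 pq.symm) (fun h => h.2 vp) ⟨by grind, by rwa [G.adj_comm]⟩
      ⟨by grind, by rwa [G.adj_comm]⟩ (fun h => h.2 ps.symm) (fun h => h.2 qt.symm) ?_ ?_
      ⟨by grind, wv⟩
    · simp only [List.nodup_cons, List.mem_cons, List.not_mem_nil]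
      grind
    · simp only [List.mem_cons, List.not_mem_nil]
      grind

theorem chromaticSymm_mem_of_meeting [Fintype V] {G : SimpleGraph V} (hG : IsUnitInterval G)
    (hGc : IsUnitInterval Gᶜ) {v p q s t : V} (vp : G.Adj v p) (vq : G.Adj v q) (pq : G.Adj p q)
    (vs : Gᶜ.Adj v s) (st : Gᶜ.Adj s t) (vt : Gᶜ.Adj v t) : chromaticSymm G ∈ elemCone := by
  have hn : [v, p, q, s, t].Nodup := by
    have hps : p ≠ s := by rintro rfl; exact vs.2 vp
    have hpt : p ≠ t := by rintro rfl; exact vt.2 vp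
    have hqs : q ≠ s := by rintro rfl; exact vs.2 vq
    have hqt : q ≠ t := by rintro rfl; exact vt.2 vq
    simp [vp.ne, vq.ne, pq.ne, vs.ne, st.ne, vt.ne, hps, hpt, hqs, hqt]
  have main : ∀ {p q : V}, G.Adj v p → G.Adj v q → G.Adj p q → [v, p, q, s, t].Nodup →
      G.Adj p s → ¬ G.Adj p t → G.Adj q t → ¬ G.Adj q s → chromaticSymm G ∈ elemCone := by
    intro p q vp vq pq hn ps pt qt qs
    have hV := mem_of_bull hG hGc vp vq pq vs.2 st.2 vt.2 ps qt pt qs hn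
    refine chromaticSymm_mem_of_bull hn hV fun x y hxy => ?_
    have hx := hV x
    have hy := hV y
    have := vp.symm
    have := vq.symm
    have := pq.symm
    have := ps.symm
    have := qt.symm
    have vs1 := vs.2
    have vs2 := vs.symm.2
    have vt1 := vt.2
    have vt2 := vt.symm.2
    have st1 := st.2
    have st2 := st.symm.2
    have tp : ¬ G.Adj t p := by rwa [G.adj_comm]
    have sq : ¬ G.Adj s q := by rwa [G.adj_comm]
    simp only [List.nodup_cons, List.mem_cons, List.not_mem_nil, or_false] at hn hx hy
    simp only [ne_eq, Sym2.eq_iff]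
    clear hV hG hGc
    rcases hx with rfl | rfl | rfl | rfl | rfl <;> rcases hy with rfl | rfl | rfl | rfl | rfl <;>
      grind
  have hn' := hn
  simp only [List.nodup_cons, List.mem_cons, List.not_mem_nil] at hn'
  -- Neither `p` nor `q` sees both `s` and `t` (claw), while each of `s`, `t` sees `p` or `q` (else
  -- it misses the triangle). Hence the edges across form a matching, which gives a bull.
  have hp : ¬ (G.Adj p s ∧ G.Adj p t) := fun h =>
    hG.not_claw vp.symm h.1 h.2 vs.ne st.ne vt.ne vs.2 st.2 vt.2
  have hq : ¬ (G.Adj q s ∧ G.Adj q t) := fun h =>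
    hG.not_claw vq.symm h.1 h.2 vs.ne st.ne vt.ne vs.2 st.2 vt.2
  have hs : G.Adj p s ∨ G.Adj q s := by
    by_contra! h
    exact hGc.not_triangle_of_isolated vp pq vq vs.ne' (by grind) (by grind) vs.symm.2
      (by rw [G.adj_comm]; exact h.1) (by rw [G.adj_comm]; exact h.2)
  have ht : G.Adj p t ∨ G.Adj q t := by
    by_contra! h
    exact hGc.not_triangle_of_isolated vp pq vq vt.ne' (by grind) (by grind) vt.symm.2
      (by rw [G.adj_comm]; exact h.1) (by rw [G.adj_comm]; exact h.2)
  rcases hs with ps | qs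
  · exact main vp vq pq hn ps (by tauto) (by tauto) (by tauto)
  · refine main vq vp pq.symm ?_ qs (by tauto) (by tauto) (by tauto)
    simp only [List.nodup_cons, List.mem_cons, List.not_mem_nil]
    grind

/-- Suppose no triangle meets an independent triple. Then a triangle vertex misses at most one of
`s`, `t`, `u`, so `p` and `q` have a common neighbor among these three; with it they form a triangle
meeting the triple. -/
theorem chromaticSymm_mem_of_triangles [Fintype V] {G : SimpleGraph V} (hG : IsUnitInterval G)
    (hGc : IsUnitInterval Gᶜ) {p q r s t u : V} (pq : G.Adj p q) (qr : G.Adj q r) (pr : G.Adj p r)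
    (st : Gᶜ.Adj s t) (tu : Gᶜ.Adj t u) (su : Gᶜ.Adj s u) : chromaticSymm G ∈ elemCone := by
  by_contra hc
  have main : ∀ {v p q s t : V}, G.Adj v p → G.Adj v q → G.Adj p q → Gᶜ.Adj v s → Gᶜ.Adj s t →
      Gᶜ.Adj v t → False :=
    fun vp vq pq vs st vt => hc (chromaticSymm_mem_of_meeting hG hGc vp vq pq vs st vt)
  have meet : ∀ {p q r : V}, G.Adj p q → G.Adj q r → G.Adj p r → p ≠ s ∧ p ≠ t ∧ p ≠ u := by
    intro p q r pq qr pr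
    refine ⟨?_, ?_, ?_⟩ <;> rintro rfl
    · exact main pq pr qr st tu su
    · exact main pq pr qr st.symm su tu
    · exact main pq pr qr su.symm st tu.symm
  have two : ∀ {p q r : V}, G.Adj p q → G.Adj q r → G.Adj p r →
      (G.Adj p s ∨ G.Adj p t) ∧ (G.Adj p t ∨ G.Adj p u) ∧ (G.Adj p s ∨ G.Adj p u) := by
    intro p q r pq qr pr
    obtain ⟨ps, pt, pu⟩ := meet pq qr pr
    refine ⟨?_, ?_, ?_⟩ <;> by_contra! h
    · exact main pq pr qr ⟨ps, h.1⟩ st ⟨pt, h.2⟩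
    · exact main pq pr qr ⟨pt, h.1⟩ tu ⟨pu, h.2⟩
    · exact main pq pr qr ⟨ps, h.1⟩ su ⟨pu, h.2⟩
  have one : ¬ (G.Adj p s ∧ G.Adj q s) ∧ ¬ (G.Adj p t ∧ G.Adj q t) ∧ ¬ (G.Adj p u ∧ G.Adj q u) := by
    refine ⟨?_, ?_, ?_⟩ <;> rintro ⟨h1, h2⟩
    · exact main h1.symm h2.symm pq st tu su
    · exact main h1.symm h2.symm pq st.symm su tu
    · exact main h1.symm h2.symm pq su.symm st tu.symm
  have hp := two pq qr pr
  have hq := two qr pr.symm pq.symm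
  tauto

/-- The edges of `G` form a path on at most four vertices. -/
def IsShortPath (G : SimpleGraph V) : Prop :=
  (∀ x y, ¬ G.Adj x y) ∨
  (∃ a b : V, a ≠ b ∧ ∀ x y, x ≠ y → (G.Adj x y ↔ s(x, y) = s(a, b))) ∨
  (∃ a b c : V, [a, b, c].Nodup ∧
    ∀ x y, x ≠ y → (G.Adj x y ↔ s(x, y) = s(a, b) ∨ s(x, y) = s(b, c))) ∨
  ∃ a b c d : V, [a, b, c, d].Nodup ∧ ∀ x y, x ≠ y →
    (G.Adj x y ↔ s(x, y) = s(a, b) ∨ s(x, y) = s(b, c) ∨ s(x, y) = s(c, d))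

theorem isShortPath_of_triangle_free {G : SimpleGraph V} (hG : IsUnitInterval G)
    (hGc : IsUnitInterval Gᶜ) (h3 : ∀ x y z, G.Adj x y → G.Adj y z → ¬ G.Adj x z) :
    IsShortPath G := by
  have hdeg : ∀ c x y z, G.Adj c x → G.Adj c y → G.Adj c z → x = y ∨ y = z ∨ x = z := by
    intro c x y z hx hy hz
    by_contra! h
    exact hG.not_claw hx hy hz h.1 h.2.1 h.2.2 (h3 _ _ _ hx.symm hy) (h3 _ _ _ hy.symm hz)
      (h3 _ _ _ hx.symm hz)
  have h22 : ∀ x y z w, G.Adj x y → G.Adj z w → G.Adj x z ∨ G.Adj x w ∨ G.Adj y z ∨ G.Adj y w := by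
    intro x y z w hxy hzw
    by_contra! h
    exact hGc.not_two_edges hxy hzw h.1 h.2.1 h.2.2.1 h.2.2.2
  have hsymm : ∀ x y, G.Adj x y → G.Adj y x := fun x y => G.adj_symm
  have hirr : ∀ x y, G.Adj x y → x ≠ y := fun x y => SimpleGraph.Adj.ne
  by_cases hp4 : ∃ a b c d, G.Adj a b ∧ G.Adj b c ∧ G.Adj c d ∧ a ≠ c ∧ b ≠ d
  · obtain ⟨a, b, c, d, hab, hbc, hcd, hac, hbd⟩ := hp4
    have had : a ≠ d := by rintro rfl; exact h3 _ _ _ hab hbc hcd.symm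
    have nac := h3 _ _ _ hab hbc
    have nbd := h3 _ _ _ hbc hcd
    have nad : ¬ G.Adj a d := fun h => hG.not_square hab hbc hcd h.symm hac hbd nac nbd
    have hb : ∀ x, G.Adj b x → x = a ∨ x = c := by
      intro x hx
      have := hdeg b a c x hab.symm hbc hx
      grind
    have hc : ∀ x, G.Adj c x → x = b ∨ x = d := by
      intro x hx
      have := hdeg c b d x hbc.symm hcd hx
      grind
    have ha : ∀ x, G.Adj a x → x = b := by
      intro x hx
      by_contra hne
      -- The edges `ax` and `cd` must be joined, and `xd` is the only link not already excluded. It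
      -- closes the induced pentagon `a b c d x`.
      have hxd : G.Adj x d := by
        have := h22 a x c d hx hcd
        grind
      have h1 : ¬ G.Adj x c := by grind
      exact hG.not_pentagon hab hbc hcd hxd.symm hx.symm hac had hbd (Ne.symm hne) (by grind) nac
        nad nbd (by grind) (by grind)
    have hd : ∀ x, G.Adj d x → x = c := by
      intro x hx
      by_contra hne
      have hxd : G.Adj x a := by
        have := h22 d x b a hx hab.symm
        grind
      have := ha x hxd.symm
      grind
    have hout : ∀ x y, G.Adj x y → x = a ∨ x = b ∨ x = c ∨ x = d := by
      intro x y hxy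
      have := h22 b c x y hbc hxy
      have := hxy.symm
      clear h22 h3 hdeg
      grind
    refine Or.inr (Or.inr (Or.inr ⟨a, b, c, d, ?_, fun x y _ => ?_⟩))
    · simp [hab.ne, hac, had, hbc.ne, hbd, hcd.ne]
    · simp only [Sym2.eq_iff]
      constructor
      · intro hxy
        have := hout x y hxy
        clear h22 h3 hdeg hout
        grind
      · grind
  by_cases hp3 : ∃ a b c, G.Adj a b ∧ G.Adj b c ∧ a ≠ c
  · obtain ⟨a, b, c, hab, hbc, hac⟩ := hp3
    have hb : ∀ x, G.Adj b x → x = a ∨ x = c := by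
      intro x hx
      have := hdeg b a c x hab.symm hbc hx
      grind
    have ha : ∀ x, G.Adj a x → x = b := by
      intro x hx
      by_contra hne
      exact hp4 ⟨x, a, b, c, hx.symm, hab, hbc, hne, hac⟩
    have hc : ∀ x, G.Adj c x → x = b := by
      intro x hx
      by_contra hne
      exact hp4 ⟨a, b, c, x, hab, hbc, hx, hac, Ne.symm hne⟩
    refine Or.inr (Or.inr (Or.inl ⟨a, b, c, ?_, fun x y _ => ?_⟩))
    · simp [hab.ne, hac, hbc.ne]
    · simp only [Sym2.eq_iff]
      constructor
      · intro hxy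
        have := h22 a b x y hab hxy
        have := hxy.symm
        clear h22 h3 hdeg
        grind
      · grind
  by_cases hp2 : ∃ a b, G.Adj a b
  · obtain ⟨a, b, hab⟩ := hp2
    have hb : ∀ x, G.Adj b x → x = a := by
      intro x hx
      by_contra hne
      exact hp3 ⟨a, b, x, hab, hx, Ne.symm hne⟩
    have ha : ∀ x, G.Adj a x → x = b := by
      intro x hx
      by_contra hne
      exact hp3 ⟨x, a, b, hx.symm, hab, hne⟩
    refine Or.inr (Or.inl ⟨a, b, hab.ne, fun x y _ => ?_⟩)
    simp only [Sym2.eq_iff]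
    constructor
    · intro hxy
      have := h22 a b x y hab hxy
      have := hxy.symm
      clear h22 h3 hdeg
      grind
    · grind
  · exact Or.inl fun x y hxy => hp2 ⟨x, y, hxy⟩

theorem IsShortPath.chromaticSymm_mem [Fintype V] {G : SimpleGraph V} (h : IsShortPath G) :
    chromaticSymm G ∈ elemCone := by
  rcases h with h | ⟨a, b, hn, h⟩ | ⟨a, b, c, hn, h⟩ | ⟨a, b, c, d, hn, h⟩
  · exact chromaticSymm_mem_of_bot h
  · exact chromaticSymm_mem_of_edge hn h
  · exact chromaticSymm_mem_of_path_three hn h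
  · exact chromaticSymm_mem_of_path_four hn h

theorem IsShortPath.chromaticSymm_mem_of_compl [Fintype V] {G : SimpleGraph V}
    (h : IsShortPath Gᶜ) : chromaticSymm G ∈ elemCone := by
  have hadj : ∀ x y, x ≠ y → (G.Adj x y ↔ ¬ Gᶜ.Adj x y) := fun x y hxy => by
    simp [SimpleGraph.compl_adj, hxy]
  rcases h with h | ⟨a, b, hn, h⟩ | ⟨a, b, c, hn, h⟩ | ⟨a, b, c, d, hn, h⟩
  · exact chromaticSymm_mem_of_top fun x y hxy => (hadj x y hxy).mpr (h x y)
  · exact chromaticSymm_mem_of_compl_edge hn fun x y hxy => by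
      rw [hadj x y hxy, h x y hxy]
  · exact chromaticSymm_mem_of_compl_path_three hn fun x y hxy => by
      rw [hadj x y hxy, h x y hxy, not_or]
  · exact chromaticSymm_mem_of_compl_path_four hn fun x y hxy => by
      rw [hadj x y hxy, h x y hxy, not_or, not_or]

end

end ChromaticSymmetric

end

theorem mainTheorem2 {V : Type*} [Fintype V] (G : SimpleGraph V)
    (hG : ChromaticSymmetric.IsUnitInterval G)
    (hGc : ChromaticSymmetric.IsUnitInterval Gᶜ) :
    ChromaticSymmetric.IsEPositive G := by
  open ChromaticSymmetric in
  refine isEPositiveSeries_of_mem ?_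
  by_cases h1 : ∀ x y z, G.Adj x y → G.Adj y z → ¬ G.Adj x z
  · exact (isShortPath_of_triangle_free hG hGc h1).chromaticSymm_mem
  by_cases h2 : ∀ x y z, Gᶜ.Adj x y → Gᶜ.Adj y z → ¬ Gᶜ.Adj x z
  · exact (isShortPath_of_triangle_free hGc (by rwa [compl_compl]) h2).chromaticSymm_mem_of_compl
  push Not at h1 h2
  obtain ⟨p, q, r, pq, qr, pr⟩ := h1
  obtain ⟨s, t, u, st, tu, su⟩ := h2
  exact chromaticSymm_mem_of_triangles hG hGc pq qr pr st tu su
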